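/- **Setting.** Fix $T>0$ and integers $n_{in},n_p\ge 0$. A set $\mathcal U\subseteq L_2([0,T],\mathbb R^{n_{in}})$ of inputs is given (for instance the whole space), and $PC([0,T],[-1,1]^{n_p})$ denotes the piecewise continuous scheduling signals. *LPV systems.* $\mathfrak L$ is a family of linear parameter-varying systems $\Sigma$ with scalar output $$\dot x=A(p(t))x+B(p(t))u(t),\quad x(0)=0,\quad y_\Sigma(u,p)(t)=C(p(t))x(t),$$ where $A(p)=A_0+\sum_{i=1}^{n_p}p_iA_i$, and $B(p)$, $C(p)$ are defined in the same way (constant matrices; the state dimension may depend on $\Sigma$). Let $\lambda\ge n_p$. Assume that for every $\Sigma\in\mathfrak L$ there is $Q\succ0$ with $$A_0^TQ+QA_0+\sum_{i=1}^{n_p}A_i^TQA_i+\sum_{i=0}^{n_p}C_i^TC_i\prec\lambda Q$$ (in particular this holds if the left-hand side is $\prec-\lambda Q$). The weighted $H_2$ norm $\|\Sigma\|_{\lambda,H_2}\in[0,\infty]$ is defined by $$\|\Sigma\|_{\lambda,H_2}^2=\sum_{j,l=0}^{n_p}\ \sum_{k\ge0}\ \sum_{i_1,\dots,i_k=1}^{n_p}\int_0^\infty\!\int_0^{t}\!\int_0^{\tau_k}\!\!\cdots\int_0^{\tau_2}\big\|C_l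 e^{A_0(t-\tau_k)}A_{i_k}e^{A_0(\tau_k-\tau_{k-1})}\cdots A_{i_1}e^{A_0\tau_1}B_j\big\|_2^2\,e^{\lambda t}\,d\tau_1\cdots d\tau_k\,dt$$ (the term for $k=0$ being $\int_0^\infty\|C_le^{A_0t}B_j\|_2^2e^{\lambda t}dt$), and $\sup_{\Sigma\in\mathfrak L}\|\Sigma\|_{\lambda,H_2}=c_1\in(0,\infty)$. *Neural ODEs.* $\Phi$ is a set of maps $\mathcal U\to PC([0,T],[-1,1]^{n_p})$. $\mathfrak S$ is a family of systems $\mathcal S$: $\dot x=f(x,u)$, $x(0)=0$, $y_{\mathcal S}(u)(t)=h(x(t))\in\mathbb R$, such that for every $\mathcal S\in\mathfrak S$ there are $\Sigma\in\mathfrak L$ and $\psi\in\Phi$ such that for all $u\in\mathcal U$ the output $y_{\mathcal S}(u)$ exists on $[0,T]$ and equals $y_\Sigma(u,\psi(u))$. *Data and loss.* $\ell:\mathbb R\times\mathbb R\to\mathbb R$ is $K_\ell$-Lipschitz, $|\ell(a,b)-\ell(a',b')|\le K_\ell(|a-a'|+|b-b'|)$, with $\ell(y,y)=0$. $\mathcal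 D$ is the joint law of a random input $\mathbf u\in\mathcal U$ and a random target $\mathbf y\in\mathbb R$, with $\|\mathbf u\|_{L_2([0,T])}\le L_u$ and $|\mathbf y|<c_2$ almost surely ($L_u,c_2>0$). For an i.i.d. sample $S=(u_i,y_i)_{i=1}^N$, $N\ge1$, let $\mathcal L_N(\mathcal S)=\frac1N\sum_{i=1}^N\ell(y_{\mathcal S}(u_i)(T),y_i)$ and $\mathcal L(\mathcal S)=\mathbb E_{\mathcal D}\,\ell(y_{\mathcal S}(\mathbf u)(T),\mathbf y)$. A number $B(T)$ is called an upper bound on the loss at time $T$ if, for almost every $(\mathbf u,\mathbf y)$, $|\ell(y_{\mathcal S}(\mathbf u)(T),\mathbf y)|\le B(T)$ for all $\mathcal S\in\mathfrak S$. **Theorem 3.** The number $2K_\ell\max\{c_2,\;c_1L_u(n_p+1)\}$ is an upper bound on the loss at time $T$. Moreover, for every upper bound $B(T)$ on the loss at time $T$ and every $\delta\in(0,1)$, $$\mathbb P_S\Big(\forall\,\mathcal S\in\mathfrak S:\ \mathcal L(\mathcal S)-\mathcal L_N(\mathcal S)\le\bar R(T,N,\delta)\Big)\ge1-\delta$$ holds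 in each of the following two cases. 1. $\Phi$ is finite and $$\bar R(T,N,\delta)=\frac{2\,\mathrm{card}(\Phi)K_\ell c_1L_u(n_p+1)}{\sqrt N}+B(T)\sqrt{\frac{2\ln(2/\delta)}N}.$$ 2. $\Phi$ is arbitrary, the family of graphs $\Phi_T=\big\{\{(u,\phi(u)):u\in\mathcal U\}:\phi\in\Phi\big\}$ has finite VC dimension $d_T$, and $$\bar R(T,N,\delta)=\sqrt2\,B(T)\Big(2+\sqrt{d_T\log(2eN/d_T)}\Big)+\frac{2K_\ell c_1L_u(n_p+1)}{\sqrt N}+B(T)\sqrt{\frac{2\ln(2/\delta)}N},$$ where $\sqrt{d_T\log(2eN/d_T)}$ is read as $0$ if $d_T=0$ or $2eN<d_T$. -/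

import Mathlib

open MeasureTheory Filter Topology Set
open scoped ENNReal Matrix

noncomputable section

/-- Input signals: the Hilbert space `L²([0,T], ℝⁿ)`, with the Euclidean norm on `ℝⁿ`. -/
abbrev L2Signal (n : ℕ) (T : ℝ) : Type :=
  Lp (EuclideanSpace ℝ (Fin n)) 2 ((volume : Measure ℝ).restrict (Icc 0 T))

/-- Piecewise continuity on `[0,T]`: continuous on `[0,T]` except at finitely many points, with
one-sided limits (along `[0,T]`) everywhere. At `0` and at `T` one of the two limits is along the
trivial filter, so it asks for nothing. -/
def PiecewiseContinuousOn {F : Type*} [TopologicalSpace F] (T : ℝ) (p : ℝ → F) : Prop :=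
  ∃ D : Finset ℝ, ∀ t ∈ Icc (0 : ℝ) T,
    (t ∉ D → ContinuousWithinAt p (Icc 0 T) t) ∧
    (∃ l, Tendsto p (𝓝[Icc 0 T ∩ Iio t] t) (𝓝 l)) ∧
    (∃ r, Tendsto p (𝓝[Icc 0 T ∩ Ioi t] t) (𝓝 r))

/-- Scheduling signals: the set `PC([0,T], [-1,1]^np)`. A signal is stored as a function on `ℝ`
that vanishes outside `[0,T]`, so that two of them are equal iff they agree on `[0,T]`. -/
@[ext] structure Scheduling (np : ℕ) (T : ℝ) where
  toFun : ℝ → Fin np → ℝ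
  piecewise : PiecewiseContinuousOn T toFun
  bounded : ∀ t i, toFun t i ∈ Icc (-1 : ℝ) 1
  off : ∀ t, t ∉ Icc (0 : ℝ) T → toFun t = 0

/-- A linear parameter-varying system with scalar output, zero initial state, `nIn` inputs and `np`
scheduling variables:
`ẋ = A(p(t)) x + B(p(t)) u`, `x(0) = 0`, `y = C(p(t)) x`, where `A(p) = A₀ + ∑ pᵢ Aᵢ` and so on.
The state dimension may vary from system to system. `C i` is a row vector. -/
structure LPV (nIn np : ℕ) where
  nx : ℕ
  A : Fin (np + 1) → Matrix (Fin nx) (Fin nx) ℝ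
  B : Fin (np + 1) → Matrix (Fin nx) (Fin nIn) ℝ
  C : Fin (np + 1) → Fin nx → ℝ

/-- `M₀ + ∑ᵢ pᵢ Mᵢ`. -/
def affineComb {np : ℕ} {V : Type*} [AddCommGroup V] [Module ℝ V]
    (M : Fin (np + 1) → V) (p : Fin np → ℝ) : V :=
  M 0 + ∑ i : Fin np, p i • M i.succ

namespace LPV

variable {nIn np : ℕ} (S : LPV nIn np)

/-- The right-hand side `A(p(t)) x(t) + B(p(t)) u(t)` of the state equation. -/
def rhs {T : ℝ} (u : L2Signal nIn T) (p : Scheduling np T) (x : ℝ → Fin S.nx → ℝ) (t : ℝ) :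
    Fin S.nx → ℝ :=
  affineComb S.A (p.toFun t) *ᵥ x t + affineComb S.B (p.toFun t) *ᵥ (u t).ofLp

/-- `y` is, on `[0,T]`, the output `y_Σ(u,p)`: there is an absolutely continuous solution `x` of
the state equation with `x(0) = 0` (written as the equivalent integral equation) with
`y(t) = C(p(t)) x(t)`. -/
def IsOutput {T : ℝ} (u : L2Signal nIn T) (p : Scheduling np T) (y : ℝ → ℝ) : Prop :=
  ∃ x : ℝ → Fin S.nx → ℝ,
    IntervalIntegrable (S.rhs u p x) volume 0 T ∧
    (∀ t ∈ Icc (0 : ℝ) T, x t = ∫ s in (0 : ℝ)..t, S.rhs u p x s) ∧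
    (∀ t ∈ Icc (0 : ℝ) T, y t = affineComb S.C (p.toFun t) ⬝ᵥ x t)

/-- `e^{A₀(t-τ_k)} A_{i_k} e^{A₀(τ_k-τ_{k-1})} ⋯ A_{i_1} e^{A₀ τ_1} B_j`, where the tuple
`τ` is `(τ_1, …, τ_k, t)`. For `k = 0` it is `e^{A₀ t} B_j`. -/
def stateKernel (j : Fin (np + 1)) :
    (k : ℕ) → (Fin k → Fin np) → (Fin (k + 1) → ℝ) → Matrix (Fin S.nx) (Fin nIn) ℝ
  | 0, _, τ => NormedSpace.exp (τ 0 • S.A 0) * S.B j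
  | k + 1, i, τ =>
      NormedSpace.exp ((τ (Fin.last (k + 1)) - τ (Fin.last k).castSucc) • S.A 0) *
        S.A (i (Fin.last k)).succ * stateKernel j k (Fin.init i) (Fin.init τ)

/-- The Volterra kernel `w(t, τ_k, …, τ_1)`, a row vector: `C_l` times the state kernel. -/
def volterraKernel (j l : Fin (np + 1)) (k : ℕ) (i : Fin k → Fin np) (τ : Fin (k + 1) → ℝ) :
    Fin nIn → ℝ :=
  S.C l ᵥ* S.stateKernel j k i τ

/-- The ordered simplex `0 ≤ τ_1 ≤ ⋯ ≤ τ_k ≤ t`, unbounded in `t`. -/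
def orderedTimes (k : ℕ) : Set (Fin (k + 1) → ℝ) := {τ | 0 ≤ τ 0 ∧ Monotone τ}

/-- The squared weighted `H₂` norm, possibly `∞`: the sum over all `j, l ∈ {0,…,np}`, all `k ≥ 0`
and all `i_1, …, i_k ∈ {1,…,np}` of
`∫_0^∞ ∫_0^t ∫_0^{τ_k} ⋯ ∫_0^{τ_2} ‖w(t,τ_k,…,τ_1)‖₂² e^{lam t} dτ_1 ⋯ dτ_k dt`. -/
def h2NormSq (lam : ℝ) : ℝ≥0∞ :=
  ∑ j : Fin (np + 1), ∑ l : Fin (np + 1), ∑' k : ℕ, ∑ i : Fin k → Fin np,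
    ∫⁻ τ in orderedTimes k,
      ENNReal.ofReal ((∑ m, (S.volterraKernel j l k i τ m) ^ 2) *
        Real.exp (lam * τ (Fin.last k)))

/-- The weighted `H₂` norm `‖Σ‖_{lam,H₂}`, possibly `∞`. -/
def h2Norm (lam : ℝ) : ℝ≥0∞ := (S.h2NormSq lam) ^ (1 / 2 : ℝ)

/-- There is `Q ≻ 0` with
`A₀ᵀ Q + Q A₀ + ∑_{i≥1} Aᵢᵀ Q Aᵢ + ∑_{i≥1} Cᵢᵀ Cᵢ + C₀ᵀ C₀ ≺ lam Q`. -/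
def SatisfiesLMI (lam : ℝ) : Prop :=
  ∃ Q : Matrix (Fin S.nx) (Fin S.nx) ℝ, Q.PosDef ∧
    (lam • Q - ((S.A 0)ᵀ * Q + Q * S.A 0
      + ∑ i : Fin np, (S.A i.succ)ᵀ * Q * S.A i.succ
      + ∑ i : Fin np, Matrix.vecMulVec (S.C i.succ) (S.C i.succ)
      + Matrix.vecMulVec (S.C 0) (S.C 0))).PosDef

end LPV

/-- A (neural) ODE `ẋ = f(x,u)`, `x(0) = 0`, `y = h(x)` with scalar output. -/
structure NeuralODE (nIn : ℕ) where
  nx : ℕ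
  f : (Fin nx → ℝ) → (Fin nIn → ℝ) → (Fin nx → ℝ)
  h : (Fin nx → ℝ) → ℝ

namespace NeuralODE

variable {nIn : ℕ} (S : NeuralODE nIn)

/-- `y` is, on `[0,T]`, an output of the ODE for the input `u`: there is an absolutely continuous
solution `x` on `[0,T]` with `x(0) = 0` (written as the equivalent integral equation) with
`y(t) = h(x(t))`. -/
def IsOutput {T : ℝ} (u : L2Signal nIn T) (y : ℝ → ℝ) : Prop :=
  ∃ x : ℝ → Fin S.nx → ℝ,
    IntervalIntegrable (fun s => S.f (x s) (u s).ofLp) volume 0 T ∧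
    (∀ t ∈ Icc (0 : ℝ) T, x t = ∫ s in (0 : ℝ)..t, S.f (x s) (u s).ofLp) ∧
    (∀ t ∈ Icc (0 : ℝ) T, y t = S.h (x t))

open Classical in
/-- The output `y_S(u)` on `[0,T]` (only used for systems whose output exists and is unique). -/
def output {T : ℝ} (u : L2Signal nIn T) : ℝ → ℝ :=
  if H : ∃ y, S.IsOutput u y then H.choose else 0

/-- On the inputs in `𝒰`, the ODE embeds into the LPV system `L` through the scheduling map `ψ`:
it has an output on `[0,T]`, and this output is the output of `L` for the input `u` and the
scheduling signal `ψ(u)`. (The output of `L` being unique on `[0,T]`, so is that of the ODE.) -/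
def EmbedsInto {np : ℕ} {T : ℝ} {𝒰 : Set (L2Signal nIn T)} (L : LPV nIn np)
    (ψ : 𝒰 → Scheduling np T) : Prop :=
  ∀ u : 𝒰, (∃ y, S.IsOutput (u : L2Signal nIn T) y) ∧
    ∀ y, S.IsOutput (u : L2Signal nIn T) y → L.IsOutput (u : L2Signal nIn T) (ψ u) y

end NeuralODE

/-- A family of sets shatters the finite set `s`. -/
def SetFamilyShatters {α : Type*} (𝒞 : Set (Set α)) (s : Finset α) : Prop :=
  ∀ t ⊆ (s : Set α), ∃ c ∈ 𝒞, (s : Set α) ∩ c = t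

/-- The family `𝒞` has (finite) VC dimension `d`: the largest cardinality of a finite shattered
set is `d`. -/
def HasVCDim {α : Type*} (𝒞 : Set (Set α)) (d : ℕ) : Prop :=
  (∃ s : Finset α, s.card = d ∧ SetFamilyShatters 𝒞 s) ∧
    ∀ s : Finset α, SetFamilyShatters 𝒞 s → s.card ≤ d

/-- The family of graphs `{(u, φ(u)) | u}`, indexed by the maps `φ` in `Φ`. -/
def graphFamily {α β : Type*} (Φ : Set (α → β)) : Set (Set (α × β)) :=
  (fun φ => {q : α × β | q.2 = φ q.1}) '' Φ

section Learning

variable {nIn : ℕ} {T : ℝ} {𝒰 : Set (L2Signal nIn T)} {Z : Type*}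

/-- The loss at time `T` of the system `S` on the data point with input `U z` and target `Y z`. -/
def lossAt (ℓ : ℝ → ℝ → ℝ) (U : Z → 𝒰) (Y : Z → ℝ) (S : NeuralODE nIn) (z : Z) : ℝ :=
  ℓ (S.output (U z : L2Signal nIn T) T) (Y z)

/-- The true risk. -/
def trueRisk [MeasurableSpace Z] (𝒟 : Measure Z) (ℓ : ℝ → ℝ → ℝ) (U : Z → 𝒰) (Y : Z → ℝ)
    (S : NeuralODE nIn) : ℝ :=
  ∫ z, lossAt ℓ U Y S z ∂𝒟

/-- The empirical risk on the sample `s`. -/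
def empiricalRisk {N : ℕ} (ℓ : ℝ → ℝ → ℝ) (U : Z → 𝒰) (Y : Z → ℝ) (S : NeuralODE nIn)
    (s : Fin N → Z) : ℝ :=
  (1 / (N : ℝ)) * ∑ i, lossAt ℓ U Y S (s i)

/-- `B` is an upper bound on the (absolute) loss at time `T`: for almost every data point it
bounds the loss of every system of the class. -/
def IsLossBound [MeasurableSpace Z] (𝒟 : Measure Z) (ℓ : ℝ → ℝ → ℝ) (U : Z → 𝒰) (Y : Z → ℝ)
    (𝔖 : Set (NeuralODE nIn)) (B : ℝ) : Prop :=
  ∀ᵐ z ∂𝒟, ∀ S ∈ 𝔖, |lossAt ℓ U Y S z| ≤ B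

/-- With probability at least `1 - δ` over an i.i.d. sample of size `N` from `𝒟`, the
generalization gap of all systems of the class is at most `R`. The event may fail to be measurable
when the class is uncountable; the outer measure of its complement is asked to be at most `δ`,
that is, the event contains a measurable one of probability at least `1 - δ`. -/
def PACBound [MeasurableSpace Z] (𝒟 : Measure Z) (ℓ : ℝ → ℝ → ℝ) (U : Z → 𝒰) (Y : Z → ℝ)
    (𝔖 : Set (NeuralODE nIn)) (N : ℕ) (δ R : ℝ) : Prop :=
  Measure.pi (fun _ : Fin N => 𝒟)
    {s | ∀ S ∈ 𝔖, trueRisk 𝒟 ℓ U Y S - empiricalRisk ℓ U Y S s ≤ R}ᶜ ≤ ENNReal.ofReal δ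

end Learning

end

set_option linter.unusedSectionVars false

/-! At time `T` the output of an LPV system is an inner product `⟪w, φ⟫` in one fixed Hilbert space,
`LPV.FeatureSpace`. The vector `w` depends only on the system, and `φ` only on the input and the
scheduling signal. To see this, variation of constants turns the state equation into a Volterra
equation whose Dyson series converges by the factorial Picard estimate. Measuring times from the
moment the input enters turns the `k`-th term into an integral over an ordered simplex of a Volterra
kernel against a product of scheduling values and one input value (`LPV.dysonIntegrand_eq`). The
weights `e^{λt/2}` on the kernels and `e^{-λt/2}` on the signals cancel in the pairing
(`LPV.output_eq_inner`).

The norm of `w` is the weighted `H₂` norm, hence at most `c₁`. For `φ`, all scheduling factors are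
at most `1` in absolute value, there are `(np+1)² np^k` index tuples of order `k`, and the simplex
below `s` has volume `s^k/k!`. Summing over `k` gives `e^{np·s}`, which the weight `e^{-λs}` absorbs
because `np ≤ λ`. So `‖φ‖ ≤ (np+1)‖u‖`, and Cauchy-Schwarz together with the Lipschitz property and
`ℓ(y,y) = 0` gives the loss bound.

For finite `Φ` the class is a finite union of balls of linear functionals composed with a Lipschitz
loss. Symmetrization (`integral_supDeviation_le`), the contraction principle
(`sum_iSup_rademacher_contraction`) and orthogonality of random signs (`sum_norm_rademacher_le`)
bound the expected uniform deviation. McDiarmid's inequality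
(`measure_pi_ge_le_of_bounded_differences`) gives concentration around it. These arguments are run
on finite classes, where suprema are measurable, and `measure_pi_gap_features_le` passes to
arbitrary ones by separability of the Hilbert space.

In the VC case the bound contains the summand `2√2·B`, while the gap between two averages of a
function bounded by `B` never exceeds `2B`. The inequality therefore holds for almost every sample
(`pacBound_of_two_mul_le`). -/

noncomputable section

/-! ### Rademacher sums and the contraction principle -/

/-- The sign `±1` encoded by a Boolean. -/
def boolSign (b : Bool) : ℝ := if b then 1 else -1

@[simp] lemma boolSign_true : boolSign true = 1 := rfl

@[simp] lemma boolSign_false : boolSign false = -1 := rfl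

@[simp] lemma boolSign_not (b : Bool) : boolSign (!b) = -boolSign b := by cases b <;> simp

lemma sum_bool_cube_succ {M : Type*} [AddCommMonoid M] {n : ℕ} (F : (Fin (n + 1) → Bool) → M) :
    ∑ σ, F σ = ∑ σ : Fin n → Bool, (F (Fin.cons true σ) + F (Fin.cons false σ)) := by
  rw [← (Fin.consEquiv fun _ => Bool).sum_comp, Fintype.sum_prod_type_right]
  simp [Fin.consEquiv]

/-- Peeling off the first sign leaves the offsets `v ± φ 0`, which the parallelogram law recombines.
The offset `v` is there to make this induction close. -/
lemma sum_norm_sq_rademacher {H : Type*} [NormedAddCommGroup H] [InnerProductSpace ℝ H] {n : ℕ}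
    (v : H) (φ : Fin n → H) :
    ∑ σ : Fin n → Bool, ‖v + ∑ k, boolSign (σ k) • φ k‖ ^ 2
      = 2 ^ n * (‖v‖ ^ 2 + ∑ k, ‖φ k‖ ^ 2) := by
  induction n generalizing v with
  | zero => simp
  | succ n ih =>
    rw [sum_bool_cube_succ, Finset.sum_add_distrib]
    simp only [Fin.sum_univ_succ, Fin.cons_zero, Fin.cons_succ, ← add_assoc]
    rw [ih, ih]
    have := parallelogram_law_with_norm ℝ v (φ 0)
    simp only [boolSign_true, boolSign_false, one_smul, neg_smul, ← sub_eq_add_neg, pow_succ] at *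
    linear_combination (2 ^ n) * this

/-- Cauchy-Schwarz over the `2^n` sign vectors replaces norms by squared norms, whose average is
exactly `∑ ‖φ k‖² ≤ n r²`. -/
lemma sum_norm_rademacher_le {H : Type*} [NormedAddCommGroup H] [InnerProductSpace ℝ H] {n : ℕ}
    (φ : Fin n → H) {r : ℝ} (hr : 0 ≤ r) (hφ : ∀ k, ‖φ k‖ ≤ r) :
    ∑ σ : Fin n → Bool, ‖∑ k, boolSign (σ k) • φ k‖ ≤ 2 ^ n * (√n * r) := by
  have h1 := sum_norm_sq_rademacher 0 φ
  have h2 := sq_sum_le_card_mul_sum_sq (s := Finset.univ)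
    (f := fun σ : Fin n → Bool => ‖∑ k, boolSign (σ k) • φ k‖)
  have h3 : ∑ k, ‖φ k‖ ^ 2 ≤ n * r ^ 2 := by
    calc ∑ k, ‖φ k‖ ^ 2 ≤ ∑ _k : Fin n, r ^ 2 :=
          Finset.sum_le_sum fun k _ => pow_le_pow_left₀ (norm_nonneg _) (hφ k) 2
      _ = n * r ^ 2 := by simp
  simp only [zero_add, norm_zero] at h1
  rw [h1] at h2
  refine abs_le_of_sq_le_sq' (h2.trans ?_) (by positivity) |>.2
  rw [mul_pow, mul_pow, Real.sq_sqrt (Nat.cast_nonneg n)]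
  simp only [Finset.card_univ, Fintype.card_pi, Fintype.card_bool, Finset.prod_const,
    Fintype.card_fin]
  push_cast
  nlinarith [mul_le_mul_of_nonneg_left h3 (by positivity : (0:ℝ) ≤ 2 ^ n * 2 ^ n)]

/-- Both suprema on the left are attained, say at `i` and `j`, and `f (a i) - f (a j) ≤ K |a i - a
j|`. The sign of `a i - a j` decides which of the two indices serves in which supremum on the right.
-/
lemma iSup_add_iSup_contraction {ι : Type*} [Finite ι] [Nonempty ι] (h a : ι → ℝ) (f : ℝ → ℝ)
    (K : ℝ) (hf : ∀ x y, |f x - f y| ≤ K * |x - y|) :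
    (⨆ i, (h i + f (a i))) + ⨆ i, (h i - f (a i))
      ≤ (⨆ i, (h i + K * a i)) + ⨆ i, (h i - K * a i) := by
  obtain ⟨i, hi⟩ := exists_eq_ciSup_of_finite (f := fun i => h i + f (a i))
  obtain ⟨j, hj⟩ := exists_eq_ciSup_of_finite (f := fun i => h i - f (a i))
  rw [← hi, ← hj]
  have b1 := fun i => le_ciSup (Set.finite_range fun i => h i + K * a i).bddAbove i
  have b2 := fun i => le_ciSup (Set.finite_range fun i => h i - K * a i).bddAbove i
  have hl := (abs_le.mp (hf (a i) (a j))).2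
  rcases abs_cases (a i - a j) with ⟨e, _⟩ | ⟨e, _⟩
  · have := b1 i; have := b2 j; rw [e] at hl; linarith
  · have := b1 j; have := b2 i; rw [e] at hl; linarith

/-- The contraction principle of Ledoux and Talagrand, for a finite class. -/
lemma sum_iSup_rademacher_contraction {ι : Type*} [Finite ι] [Nonempty ι] {n : ℕ} (h : ι → ℝ)
    (a : ι → Fin n → ℝ) (f : Fin n → ℝ → ℝ) (K : ℝ)
    (hf : ∀ k x y, |f k x - f k y| ≤ K * |x - y|) :
    ∑ σ : Fin n → Bool, ⨆ i, (h i + ∑ k, boolSign (σ k) * f k (a i k))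
      ≤ ∑ σ : Fin n → Bool, ⨆ i, (h i + ∑ k, boolSign (σ k) * (K * a i k)) := by
  induction n generalizing h with
  | zero => simp
  | succ n ih =>
    rw [sum_bool_cube_succ, sum_bool_cube_succ, Finset.sum_add_distrib]
    simp only [Fin.sum_univ_succ, Fin.cons_zero, Fin.cons_succ, ← add_assoc, boolSign_true,
      boolSign_false, one_mul, neg_one_mul]
    -- The later coordinates are contracted first, with the first signed term absorbed into the
    -- offset. Then the first coordinate is contracted for each fixed choice of the other signs.
    refine (add_le_add (ih (fun i => h i + f 0 (a i 0)) (fun i k => a i k.succ) (fun k => f k.succ)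
      fun k => hf k.succ) (ih (fun i => h i + -f 0 (a i 0)) (fun i k => a i k.succ)
      (fun k => f k.succ) fun k => hf k.succ)).trans ?_
    rw [← Finset.sum_add_distrib]
    refine Finset.sum_le_sum fun σ _ => ?_
    have := iSup_add_iSup_contraction (fun i => h i + ∑ k : Fin n, boolSign (σ k) *
      (K * a i k.succ)) (fun i => a i 0) (f 0) K (hf 0)
    refine le_trans (le_of_eq ?_) (this.trans (le_of_eq ?_)) <;> congr 1 <;>
      (congr 1; ext i; ring)

/-! ### McDiarmid's inequality -/

section McDiarmid

variable {Z : Type*} [MeasurableSpace Z]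

lemma integral_pi_fin_succ (𝒟 : Measure Z) [IsProbabilityMeasure 𝒟] {n : ℕ}
    (g : (Fin (n + 1) → Z) → ℝ) (hg : Measurable g) {M : ℝ} (hM : ∀ s, |g s| ≤ M) :
    ∫ s, g s ∂(Measure.pi fun _ : Fin (n + 1) => 𝒟)
      = ∫ z, ∫ s, g (Fin.cons z s) ∂(Measure.pi fun _ : Fin n => 𝒟) ∂𝒟 := by
  have hp := (measurePreserving_piFinSuccAbove (fun _ : Fin (n + 1) => 𝒟) 0).symm
  have e := hp.integral_comp' g
  rw [← e, integral_prod]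
  · simp [MeasurableEquiv.piFinSuccAbove, Fin.insertNthEquiv]
  · exact Integrable.of_bound (hg.comp (MeasurableEquiv.measurable _)).aestronglyMeasurable M
      (ae_of_all _ fun s => hM _)

lemma measurable_fin_cons {n : ℕ} :
    Measurable fun q : Z × (Fin n → Z) => (Fin.cons q.1 q.2 : Fin (n + 1) → Z) := by
  refine measurable_pi_lambda _ fun i => ?_
  refine Fin.cases ?_ (fun j => ?_) i
  · exact measurable_fst
  · exact (measurable_pi_apply j).comp measurable_snd

/-- The moment generating function bound behind McDiarmid's inequality. -/
lemma integral_exp_sub_integral_le (𝒟 : Measure Z) [IsProbabilityMeasure 𝒟] {c : ℝ} {n : ℕ}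
    (g : (Fin n → Z) → ℝ) (hg : Measurable g) {M : ℝ} (hM : ∀ s, |g s| ≤ M)
    (hd : ∀ s i z, |g s - g (Function.update s i z)| ≤ c) (t : ℝ) :
    ∫ s, Real.exp (t * (g s - ∫ s', g s' ∂(Measure.pi fun _ : Fin n => 𝒟)))
        ∂(Measure.pi fun _ : Fin n => 𝒟) ≤ Real.exp (n * (c ^ 2 / 4) * t ^ 2 / 2) := by
  induction n with
  | zero =>
    have : ∀ s : Fin 0 → Z, g s = g default := fun s => by rw [Subsingleton.elim s default]
    simp [this]
  | succ n ih =>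
    set P := Measure.pi fun _ : Fin n => 𝒟
    have hgc : Measurable fun q : Z × (Fin n → Z) => g (Fin.cons q.1 q.2) :=
      hg.comp measurable_fin_cons
    have hgz : ∀ z, Measurable fun s : Fin n → Z => g (Fin.cons z s) := fun z =>
      hgc.comp measurable_prodMk_left
    have hint : ∀ z, Integrable (fun s : Fin n → Z => g (Fin.cons z s)) P := fun z =>
      Integrable.of_bound (hgz z).aestronglyMeasurable M (ae_of_all _ fun s => hM _)
    -- `h` is the conditional expectation of `g` given the first coordinate. Its fluctuation is
    -- handled by Hoeffding's lemma, and that of `g (Fin.cons z ·)` around `h z` by induction.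
    set h : Z → ℝ := fun z => ∫ s, g (Fin.cons z s) ∂P with hh
    have hhm : Measurable h := hgc.stronglyMeasurable.integral_prod_right.measurable
    have hhM : ∀ z, |h z| ≤ M := fun z => by
      have := norm_integral_le_of_norm_le_const (μ := P) (C := M)
        (f := fun s => g (Fin.cons z s)) (ae_of_all _ fun s => hM _)
      simpa using this
    obtain ⟨z₀⟩ : Nonempty Z := nonempty_of_isProbabilityMeasure 𝒟
    have hosc : ∀ z z', h z - h z' ≤ c := fun z z' => by
      rw [hh]; simp only
      rw [← integral_sub (hint _) (hint _)]
      have : ∫ s, (g (Fin.cons z s) - g (Fin.cons z' s)) ∂P ≤ ∫ _s, c ∂P := by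
        refine integral_mono ((hint _).sub (hint _)) (integrable_const _) fun s => ?_
        have := hd (Fin.cons z s) 0 z'
        rw [Fin.update_cons_zero] at this
        exact (abs_le.mp this).2
      simpa using this
    have hbdd : BddBelow (Set.range h) := ⟨-M, by rintro _ ⟨z, rfl⟩; exact (abs_le.mp (hhM z)).1⟩
    have : Nonempty Z := ⟨z₀⟩
    -- An interval of length `c` is what Hoeffding's lemma needs; it yields the variance proxy
    -- `c²/4` per coordinate.
    have hmem : ∀ z, h z ∈ Set.Icc (⨅ z, h z) ((⨅ z, h z) + c) := fun z =>
      ⟨ciInf_le hbdd z, by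
        have := le_ciInf (f := h) (c := h z - c) fun z' => by linarith [hosc z z']
        linarith⟩
    have hE : ∫ s, g s ∂(Measure.pi fun _ : Fin (n + 1) => 𝒟) = ∫ z, h z ∂𝒟 :=
      integral_pi_fin_succ 𝒟 g hg hM
    have hc : 0 ≤ c := by simpa using hosc z₀ z₀
    have hH := (ProbabilityTheory.hasSubgaussianMGF_of_mem_Icc (μ := 𝒟) hhm.aemeasurable
      (ae_of_all _ hmem)).mgf_le t
    simp only [ProbabilityTheory.mgf, add_sub_cancel_left, NNReal.coe_pow, NNReal.coe_div,
      coe_nnnorm, NNReal.coe_ofNat, Real.norm_eq_abs, abs_of_nonneg hc] at hH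
    have hexpM : ∀ s, |Real.exp (t * (g s - ∫ z, h z ∂𝒟))| ≤
        Real.exp (|t| * (M + |∫ z, h z ∂𝒟|)) := fun s => by
      rw [Real.abs_exp]
      refine Real.exp_le_exp.mpr ((le_abs_self _).trans ?_)
      rw [abs_mul]
      exact mul_le_mul_of_nonneg_left ((abs_sub _ _).trans (by gcongr; exact hM s)) (abs_nonneg _)
    rw [hE, integral_pi_fin_succ 𝒟 _ (by fun_prop) hexpM]
    have key : ∀ z, ∫ s, Real.exp (t * (g (Fin.cons z s) - ∫ z, h z ∂𝒟)) ∂P ≤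
        Real.exp (t * (h z - ∫ z, h z ∂𝒟)) * Real.exp (n * (c ^ 2 / 4) * t ^ 2 / 2) := fun z => by
      have := ih (fun s => g (Fin.cons z s)) (hgz z) (fun s => hM _) (fun s i z' => by
        have := hd (Fin.cons z s) i.succ z'
        rwa [← Fin.cons_update] at this)
      refine le_trans (le_of_eq ?_) (mul_le_mul_of_nonneg_left this (Real.exp_pos _).le)
      rw [← integral_const_mul]
      congr 1; ext s
      rw [← Real.exp_add]; congr 1; simp only [hh, P]; ring
    have hi2 : Integrable (fun z => Real.exp (t * (h z - ∫ z, h z ∂𝒟)) *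
        Real.exp (n * (c ^ 2 / 4) * t ^ 2 / 2)) 𝒟 := by
      refine Integrable.mul_const ?_ _
      refine Integrable.of_bound (C := Real.exp (|t| * (M + |∫ z, h z ∂𝒟|)))
        (by fun_prop : Measurable _).aestronglyMeasurable (ae_of_all _ fun z => ?_)
      rw [Real.norm_eq_abs, Real.abs_exp]
      refine Real.exp_le_exp.mpr ((le_abs_self _).trans ?_)
      rw [abs_mul]
      exact mul_le_mul_of_nonneg_left ((abs_sub _ _).trans (by gcongr; exact hhM z)) (abs_nonneg _)
    refine (integral_mono_of_nonneg (ae_of_all _ fun z => integral_nonneg fun s =>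
      (Real.exp_pos _).le) hi2 (ae_of_all _ key)).trans ?_
    rw [integral_mul_const]
    refine (mul_le_mul_of_nonneg_right hH (Real.exp_pos _).le).trans ?_
    rw [← Real.exp_add]
    refine Real.exp_le_exp.mpr (le_of_eq ?_)
    push_cast; ring

/-- McDiarmid's bounded differences inequality. -/
lemma measure_pi_ge_le_of_bounded_differences (𝒟 : Measure Z) [IsProbabilityMeasure 𝒟] {c : ℝ}
    {n : ℕ} (g : (Fin n → Z) → ℝ) (hg : Measurable g) {M : ℝ} (hM : ∀ s, |g s| ≤ M)
    (hd : ∀ s i z, |g s - g (Function.update s i z)| ≤ c) {ε : ℝ} (hε : 0 ≤ ε) :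
    (Measure.pi fun _ : Fin n => 𝒟).real
      {s | ε ≤ g s - ∫ s', g s' ∂(Measure.pi fun _ : Fin n => 𝒟)} ≤
        Real.exp (-ε ^ 2 / (2 * (n * (c ^ 2 / 4)))) := by
  set P := Measure.pi fun _ : Fin n => 𝒟
  have H : ProbabilityTheory.HasSubgaussianMGF (fun s => g s - ∫ s', g s' ∂P)
      (⟨n * (c ^ 2 / 4), by positivity⟩) P := by
    refine ⟨fun t => ?_, fun t => integral_exp_sub_integral_le 𝒟 g hg hM hd t⟩
    refine Integrable.of_bound (C := Real.exp (|t| * (M + |∫ s, g s ∂P|)))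
      (by fun_prop : Measurable _).aestronglyMeasurable (ae_of_all _ fun z => ?_)
    rw [Real.norm_eq_abs, Real.abs_exp]
    refine Real.exp_le_exp.mpr ((le_abs_self _).trans ?_)
    rw [abs_mul]
    exact mul_le_mul_of_nonneg_left ((abs_sub _ _).trans (by gcongr; exact hM z)) (abs_nonneg _)
  exact H.measure_ge_le hε

end McDiarmid

/-! ### Symmetrization and the bound for finite bounded classes -/

section Symmetrization


variable {Z : Type*} [MeasurableSpace Z] {ι : Type*} [Finite ι] [Nonempty ι] {N : ℕ}

/-- The supremum over a class of functions of a signed sum over the sample. -/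
def radSup (f : ι → Z → ℝ) (σ : Fin N → Bool) (s : Fin N → Z) : ℝ :=
  ⨆ i, ∑ k, boolSign (σ k) * f i (s k)

/-- The uniform deviation of a class of functions, multiplied by the sample size. -/
def supDeviation (𝒟 : Measure Z) (f : ι → Z → ℝ) (s : Fin N → Z) : ℝ :=
  ⨆ i, (N * ∫ z, f i z ∂𝒟 - ∑ k, f i (s k))

lemma abs_ciSup_le_of_finite {a : ι → ℝ} {M : ℝ} (h : ∀ i, |a i| ≤ M) : |⨆ i, a i| ≤ M := by
  obtain ⟨i, hi⟩ := exists_eq_ciSup_of_finite (f := a)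
  rw [← hi]; exact h i

lemma abs_boolSign (b : Bool) : |boolSign b| = 1 := by cases b <;> simp

variable {f : ι → Z → ℝ} {B : ℝ}

lemma measurable_radSup (hf : ∀ i, Measurable (f i)) (σ : Fin N → Bool) :
    Measurable (radSup f σ) :=
  Measurable.iSup fun i => Finset.measurable_sum _ fun k _ =>
    ((hf i).comp (measurable_pi_apply k)).const_mul _

lemma abs_radSup_le (hB : ∀ i z, |f i z| ≤ B) (σ : Fin N → Bool) (s : Fin N → Z) :
    |radSup f σ s| ≤ N * B := by
  refine abs_ciSup_le_of_finite fun i => (Finset.abs_sum_le_sum_abs _ _).trans ?_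
  calc ∑ k, |boolSign (σ k) * f i (s k)| ≤ ∑ _k : Fin N, B :=
        Finset.sum_le_sum fun k _ => by rw [abs_mul, abs_boolSign, one_mul]; exact hB _ _
    _ = N * B := by simp

lemma measurable_supDeviation (𝒟 : Measure Z) (hf : ∀ i, Measurable (f i)) :
    Measurable (supDeviation (N := N) 𝒟 f) :=
  Measurable.iSup fun i => (Finset.measurable_sum _ fun k _ =>
    ((hf i).comp (measurable_pi_apply k))).const_sub _

lemma abs_sum_sample_le (hB : ∀ i z, |f i z| ≤ B) (i : ι) (s : Fin N → Z) :
    |∑ k, f i (s k)| ≤ N * B := by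
  refine (Finset.abs_sum_le_sum_abs _ _).trans ?_
  calc ∑ k, |f i (s k)| ≤ ∑ _k : Fin N, B := Finset.sum_le_sum fun k _ => hB _ _
    _ = N * B := by simp

lemma abs_supDeviation_le (𝒟 : Measure Z) [IsProbabilityMeasure 𝒟] (hB : ∀ i z, |f i z| ≤ B)
    (s : Fin N → Z) : |supDeviation 𝒟 f s| ≤ N * B + N * B := by
  refine abs_ciSup_le_of_finite fun i => (abs_sub _ _).trans (add_le_add ?_
    (abs_sum_sample_le hB i s))
  rw [abs_mul, Nat.abs_cast]
  gcongr
  simpa using norm_integral_le_of_norm_le_const (μ := 𝒟) (C := B) (f := f i)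
    (ae_of_all _ fun z => hB i z)

/-- Replacing one sample point moves each of the sums by at most `2B`, and a supremum moves no more
than its members. This is the bounded-differences condition for McDiarmid. -/
lemma abs_supDeviation_update_le (𝒟 : Measure Z) (hB : ∀ i z, |f i z| ≤ B) (s : Fin N → Z)
    (k : Fin N) (z : Z) :
    |supDeviation 𝒟 f s - supDeviation 𝒟 f (Function.update s k z)| ≤ 2 * B := by
  have key : ∀ i, |∑ j, f i (s j) - ∑ j, f i (Function.update s k z j)| ≤ 2 * B := fun i => by
    rw [← Finset.sum_sub_distrib, Finset.sum_eq_single k]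
    · rw [Function.update_self]
      have := hB i (s k); have := hB i z
      exact (abs_sub _ _).trans (by linarith)
    · intro j _ hj
      rw [Function.update_of_ne hj, sub_self]
    · simp
  have hle : ∀ s' : Fin N → Z, ∀ i,
      N * ∫ z, f i z ∂𝒟 - ∑ k, f i (s' k) ≤ supDeviation 𝒟 f s' := fun s' i =>
    le_ciSup (f := fun i => N * ∫ z, f i z ∂𝒟 - ∑ k, f i (s' k)) (Set.finite_range _).bddAbove i
  rw [abs_le]
  constructor
  · have : supDeviation 𝒟 f (Function.update s k z) ≤ supDeviation 𝒟 f s + 2 * B :=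
      ciSup_le fun i => by
        have := hle s i; have := abs_le.mp (key i); linarith
    linarith
  · have : supDeviation 𝒟 f s ≤ supDeviation 𝒟 f (Function.update s k z) + 2 * B :=
      ciSup_le fun i => by
        have := hle (Function.update s k z) i; have := abs_le.mp (key i); linarith
    linarith

/-- The supremum over a class of functions of a signed sum of differences over a double sample. -/
def pairSup (f : ι → Z → ℝ) (σ : Fin N → Bool) (q : Fin N → Z × Z) : ℝ :=
  ⨆ i, ∑ k, boolSign (σ k) * (f i (q k).2 - f i (q k).1)

lemma measurable_pairSup (hf : ∀ i, Measurable (f i)) (σ : Fin N → Bool) :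
    Measurable (pairSup f σ) :=
  Measurable.iSup fun i => Finset.measurable_sum _ fun k _ =>
    (((hf i).comp (measurable_snd.comp (measurable_pi_apply k))).sub
      ((hf i).comp (measurable_fst.comp (measurable_pi_apply k)))).const_mul _

lemma abs_pairSup_le (hB : ∀ i z, |f i z| ≤ B) (σ : Fin N → Bool) (q : Fin N → Z × Z) :
    |pairSup f σ q| ≤ N * (B + B) := by
  refine abs_ciSup_le_of_finite fun i => (Finset.abs_sum_le_sum_abs _ _).trans ?_
  calc ∑ k, |boolSign (σ k) * (f i (q k).2 - f i (q k).1)| ≤ ∑ _k : Fin N, (B + B) :=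
        Finset.sum_le_sum fun k _ => by
          rw [abs_mul, abs_boolSign, one_mul]
          exact (abs_sub _ _).trans (add_le_add (hB _ _) (hB _ _))
    _ = N * (B + B) := by simp [mul_add]

/-- Exchanging the two members of the `k`-th pair preserves the law of the double sample and flips
the sign of the `k`-th difference. -/
lemma integral_pairSup_eq (𝒟 : Measure Z) [IsProbabilityMeasure 𝒟] (hf : ∀ i, Measurable (f i))
    (σ : Fin N → Bool) :
    ∫ q, pairSup f σ q ∂(Measure.pi fun _ : Fin N => 𝒟.prod 𝒟)
      = ∫ q, pairSup f (fun _ => true) q ∂(Measure.pi fun _ : Fin N => 𝒟.prod 𝒟) := by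
  have hmp : MeasurePreserving
      (fun (q : Fin N → Z × Z) k => (if σ k then id else Prod.swap) (q k))
      (Measure.pi fun _ : Fin N => 𝒟.prod 𝒟) (Measure.pi fun _ : Fin N => 𝒟.prod 𝒟) := by
    refine measurePreserving_pi (fun _ : Fin N => 𝒟.prod 𝒟) (fun _ : Fin N => 𝒟.prod 𝒟)
      (f := fun k => if σ k then id else Prod.swap) fun k => ?_
    by_cases h : σ k
    · simpa [h] using MeasurePreserving.id _
    · simpa [h] using Measure.measurePreserving_swap
  conv_rhs => rw [← hmp.map_eq, integral_map hmp.measurable.aemeasurable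
    (measurable_pairSup hf _).aestronglyMeasurable]
  congr 1; ext q
  unfold pairSup
  congr 1; ext i
  refine Finset.sum_congr rfl fun k _ => ?_
  cases h : σ k <;> simp [h]

/-- The true mean is an average over an independent ghost sample, and the supremum of an average is
at most the average of the supremum. -/
lemma integral_supDeviation_le_integral_pairSup (𝒟 : Measure Z) [IsProbabilityMeasure 𝒟]
    (hf : ∀ i, Measurable (f i)) (hB : ∀ i z, |f i z| ≤ B) :
    ∫ s, supDeviation 𝒟 f s ∂(Measure.pi fun _ : Fin N => 𝒟)
      ≤ ∫ q, pairSup f (fun _ => true) q ∂(Measure.pi fun _ : Fin N => 𝒟.prod 𝒟) := by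
  set P := Measure.pi fun _ : Fin N => 𝒟
  have hmp := measurePreserving_arrowProdEquivProdArrow Z Z (Fin N) (fun _ => 𝒟) (fun _ => 𝒟)
  set G : (Fin N → Z) × (Fin N → Z) → ℝ := fun q => ⨆ i, (∑ k, f i (q.2 k) - ∑ k, f i (q.1 k))
    with hG
  have hGm : Measurable G := Measurable.iSup fun i =>
    (Finset.measurable_sum _ fun k _ => (hf i).comp ((measurable_pi_apply k).comp measurable_snd)).sub
    (Finset.measurable_sum _ fun k _ => (hf i).comp ((measurable_pi_apply k).comp measurable_fst))
  have hGb : ∀ q, ‖G q‖ ≤ N * B + N * B := fun q => abs_ciSup_le_of_finite fun i =>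
    (abs_sub _ _).trans (add_le_add (abs_sum_sample_le hB i _) (abs_sum_sample_le hB i _))
  have hGi : Integrable G (P.prod P) := Integrable.of_bound hGm.aestronglyMeasurable _
    (ae_of_all _ hGb)
  have e : ∫ q, pairSup f (fun _ => true) q ∂(Measure.pi fun _ : Fin N => 𝒟.prod 𝒟)
      = ∫ s, ∫ s', G (s, s') ∂P ∂P := by
    rw [← integral_prod _ hGi, ← hmp.integral_comp']
    congr 1; ext q
    simp [pairSup, hG, MeasurableEquiv.arrowProdEquivProdArrow, Equiv.arrowProdEquivProdArrow]
  rw [e]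
  refine integral_mono (Integrable.of_bound (measurable_supDeviation 𝒟 hf).aestronglyMeasurable _
    (ae_of_all _ fun s => abs_supDeviation_le 𝒟 hB s)) hGi.integral_prod_left fun s => ?_
  refine ciSup_le fun i => ?_
  have hfi : Integrable (f i) 𝒟 := Integrable.of_bound (hf i).aestronglyMeasurable B
    (ae_of_all _ (hB i))
  have hk : ∀ k : Fin N, Integrable (fun s' : Fin N → Z => f i (s' k)) P := fun k =>
    (measurePreserving_eval (fun _ : Fin N => 𝒟) k).integrable_comp_of_integrable hfi
  have h1 : ∫ s' : Fin N → Z, ∑ k, f i (s' k) ∂P = N * ∫ z, f i z ∂𝒟 := by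
    rw [integral_finsetSum _ fun k _ => hk k]
    have : ∀ k : Fin N, ∫ s' : Fin N → Z, f i (s' k) ∂P = ∫ z, f i z ∂𝒟 := fun k => by
      have h := measurePreserving_eval (fun _ : Fin N => 𝒟) k
      rw [← h.map_eq, integral_map h.measurable.aemeasurable (hf i).aestronglyMeasurable]
    simp [this]
  have h2 : N * ∫ z, f i z ∂𝒟 - ∑ k, f i (s k)
      = ∫ s', (∑ k, f i (s' k) - ∑ k, f i (s k)) ∂P := by
    rw [integral_sub (integrable_finsetSum _ fun k _ => hk k) (integrable_const _), h1]
    simp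
  rw [h2]
  refine integral_mono ((integrable_finsetSum _ fun k _ => hk k).sub (integrable_const _))
    (Integrable.of_bound (hGm.comp measurable_prodMk_left).aestronglyMeasurable _
    (ae_of_all _ fun s' => hGb (s, s'))) fun s' => ?_
  exact le_ciSup (f := fun i => ∑ k, f i (s' k) - ∑ k, f i (s k)) (Set.finite_range _).bddAbove i

/-- The supremum of a sum is at most the sum of the suprema. Each half of the double sample is again
an i.i.d. sample, and the minus sign is moved into the Rademacher signs. -/
lemma integral_pairSup_le (𝒟 : Measure Z) [IsProbabilityMeasure 𝒟] (hf : ∀ i, Measurable (f i))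
    (hB : ∀ i z, |f i z| ≤ B) (σ : Fin N → Bool) :
    ∫ q, pairSup f σ q ∂(Measure.pi fun _ : Fin N => 𝒟.prod 𝒟)
      ≤ ∫ s, radSup f σ s ∂(Measure.pi fun _ : Fin N => 𝒟)
        + ∫ s, radSup f (fun k => !σ k) s ∂(Measure.pi fun _ : Fin N => 𝒟) := by
  have m1 : MeasurePreserving (fun (q : Fin N → Z × Z) k => (q k).1)
      (Measure.pi fun _ : Fin N => 𝒟.prod 𝒟) (Measure.pi fun _ : Fin N => 𝒟) :=
    measurePreserving_pi _ _ (f := fun _ => Prod.fst) fun k => measurePreserving_fst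
  have m2 : MeasurePreserving (fun (q : Fin N → Z × Z) k => (q k).2)
      (Measure.pi fun _ : Fin N => 𝒟.prod 𝒟) (Measure.pi fun _ : Fin N => 𝒟) :=
    measurePreserving_pi _ _ (f := fun _ => Prod.snd) fun k => measurePreserving_snd
  have hi : ∀ τ : Fin N → Bool, Integrable (radSup f τ) (Measure.pi fun _ : Fin N => 𝒟) := fun τ =>
    Integrable.of_bound (measurable_radSup hf τ).aestronglyMeasurable _
      (ae_of_all _ (abs_radSup_le hB τ))
  have e1 : ∀ τ, ∫ s, radSup f τ s ∂(Measure.pi fun _ : Fin N => 𝒟)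
      = ∫ q, radSup f τ (fun k => (q k).1) ∂(Measure.pi fun _ : Fin N => 𝒟.prod 𝒟) := fun τ => by
    rw [← m1.map_eq, integral_map m1.measurable.aemeasurable
      (measurable_radSup hf _).aestronglyMeasurable]
  have e2 : ∀ τ, ∫ s, radSup f τ s ∂(Measure.pi fun _ : Fin N => 𝒟)
      = ∫ q, radSup f τ (fun k => (q k).2) ∂(Measure.pi fun _ : Fin N => 𝒟.prod 𝒟) := fun τ => by
    rw [← m2.map_eq, integral_map m2.measurable.aemeasurable
      (measurable_radSup hf _).aestronglyMeasurable]
  have i1 : Integrable (fun q : Fin N → Z × Z => radSup f (fun k => !σ k) fun k => (q k).1)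
      (Measure.pi fun _ : Fin N => 𝒟.prod 𝒟) := m1.integrable_comp_of_integrable (hi _)
  have i2 : Integrable (fun q : Fin N → Z × Z => radSup f σ fun k => (q k).2)
      (Measure.pi fun _ : Fin N => 𝒟.prod 𝒟) := m2.integrable_comp_of_integrable (hi _)
  rw [e2, e1, ← integral_add i2 i1]
  refine integral_mono (Integrable.of_bound (measurable_pairSup hf σ).aestronglyMeasurable _
    (ae_of_all _ (abs_pairSup_le hB σ))) (i2.add i1) fun q => ?_
  refine ciSup_le fun i => ?_
  have b1 := le_ciSup (f := fun i => ∑ k, boolSign (σ k) * f i (q k).2)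
    (Set.finite_range _).bddAbove i
  have b2 := le_ciSup (f := fun i => ∑ k, boolSign (!σ k) * f i (q k).1)
    (Set.finite_range _).bddAbove i
  refine le_trans (le_of_eq ?_) (add_le_add b1 b2)
  rw [← Finset.sum_add_distrib]
  refine Finset.sum_congr rfl fun k _ => ?_
  rw [boolSign_not]; ring

/-- Symmetrization: the expected uniform deviation is at most twice the Rademacher average. -/
lemma integral_supDeviation_le (𝒟 : Measure Z) [IsProbabilityMeasure 𝒟] (hf : ∀ i, Measurable (f i))
    (hB : ∀ i z, |f i z| ≤ B) {R : ℝ}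
    (hR : ∀ᵐ s ∂(Measure.pi fun _ : Fin N => 𝒟), ∑ σ, radSup f σ s ≤ 2 ^ N * R) :
    ∫ s, supDeviation 𝒟 f s ∂(Measure.pi fun _ : Fin N => 𝒟) ≤ 2 * R := by
  set P := Measure.pi fun _ : Fin N => 𝒟
  have hi : ∀ τ : Fin N → Bool, Integrable (radSup f τ) P := fun τ =>
    Integrable.of_bound (measurable_radSup hf τ).aestronglyMeasurable _
      (ae_of_all _ (abs_radSup_le hB τ))
  have h1 : ∀ σ : Fin N → Bool, ∫ s, supDeviation 𝒟 f s ∂P ≤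
      ∫ s, radSup f σ s ∂P + ∫ s, radSup f (fun k => !σ k) s ∂P := fun σ =>
    ((integral_supDeviation_le_integral_pairSup 𝒟 hf hB).trans_eq
      (integral_pairSup_eq 𝒟 hf σ).symm).trans (integral_pairSup_le 𝒟 hf hB σ)
  have h2 := Finset.sum_le_sum fun (σ : Fin N → Bool) (_ : σ ∈ Finset.univ) => h1 σ
  -- Flipping all signs permutes the sign vectors, so the two halves contribute equally; hence the
  -- factor `2`.
  have h3 : ∑ σ : Fin N → Bool, ∫ s, radSup f (fun k => !σ k) s ∂P
      = ∑ σ : Fin N → Bool, ∫ s, radSup f σ s ∂P :=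
    (Equiv.arrowCongr (Equiv.refl (Fin N)) Equiv.boolNot).sum_comp
      (fun σ => ∫ s, radSup f σ s ∂P)
  have h4 : ∑ σ : Fin N → Bool, ∫ s, radSup f σ s ∂P ≤ 2 ^ N * R := by
    rw [← integral_finsetSum _ fun σ _ => hi σ]
    have := integral_mono_ae (integrable_finsetSum _ fun σ _ => hi σ) (integrable_const _) hR
    simpa using this
  rw [Finset.sum_add_distrib, h3] at h2
  simp only [Finset.sum_const, Finset.card_univ, Fintype.card_pi, Fintype.card_bool,
    Finset.prod_const, Fintype.card_fin, nsmul_eq_mul] at h2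
  push_cast at h2
  have h5 : (2 : ℝ) ^ N * ∫ s, supDeviation 𝒟 f s ∂P ≤ 2 ^ N * (2 * R) := by linarith
  exact le_of_mul_le_mul_left h5 (by positivity)

/-- The generalization bound for a finite class of bounded functions. -/
lemma measure_pi_gap_le (𝒟 : Measure Z) [IsProbabilityMeasure 𝒟] (hf : ∀ i, Measurable (f i))
    (hB : ∀ i z, |f i z| ≤ B) (hB0 : 0 < B) (hN : 0 < N) {R : ℝ}
    (hR : ∀ᵐ s ∂(Measure.pi fun _ : Fin N => 𝒟), ∑ σ, radSup f σ s ≤ 2 ^ N * R)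
    {δ : ℝ} (hδ : δ ∈ Ioo (0 : ℝ) 1) :
    (Measure.pi fun _ : Fin N => 𝒟)
      {s | ∃ i, 2 * R / N + B * √(2 * Real.log (2 / δ) / N)
        < ∫ z, f i z ∂𝒟 - 1 / (N : ℝ) * ∑ k, f i (s k)} ≤ ENNReal.ofReal δ := by
  have hN' : (0 : ℝ) < N := Nat.cast_pos.mpr hN
  set P := Measure.pi fun _ : Fin N => 𝒟
  set ε := N * (B * √(2 * Real.log (2 / δ) / N)) with hε
  have hlog : 0 ≤ Real.log (2 / δ) :=
    Real.log_nonneg (by rw [le_div_iff₀ hδ.1]; linarith [hδ.2])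
  have hsub : {s : Fin N → Z | ∃ i, 2 * R / N + B * √(2 * Real.log (2 / δ) / N)
        < ∫ z, f i z ∂𝒟 - 1 / (N : ℝ) * ∑ k, f i (s k)} ⊆
      {s | ε ≤ supDeviation 𝒟 f s - ∫ s', supDeviation 𝒟 f s' ∂P} := by
    rintro s ⟨i, hi⟩
    have h1 := integral_supDeviation_le 𝒟 hf hB hR
    have h2 : N * ∫ z, f i z ∂𝒟 - ∑ k, f i (s k) ≤ supDeviation 𝒟 f s :=
      le_ciSup (f := fun i => N * ∫ z, f i z ∂𝒟 - ∑ k, f i (s k)) (Set.finite_range _).bddAbove i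
    have h3 := mul_lt_mul_of_pos_left hi hN'
    have h4 : (N : ℝ) * (2 * R / N + B * √(2 * Real.log (2 / δ) / N)) = 2 * R + ε := by
      rw [hε]; field_simp
    have h5 : (N : ℝ) * (∫ z, f i z ∂𝒟 - 1 / (N : ℝ) * ∑ k, f i (s k))
        = N * ∫ z, f i z ∂𝒟 - ∑ k, f i (s k) := by field_simp
    simp only [Set.mem_ofPred_eq]
    linarith
  refine (measure_mono hsub).trans ?_
  have hM := measure_pi_ge_le_of_bounded_differences 𝒟 (n := N) (supDeviation 𝒟 f)
    (measurable_supDeviation 𝒟 hf) (abs_supDeviation_le 𝒟 hB) (abs_supDeviation_update_le 𝒟 hB)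
    (ε := ε) (by positivity)
  rw [← ENNReal.ofReal_toReal (measure_ne_top P _)]
  refine ENNReal.ofReal_le_ofReal (hM.trans ?_)
  -- The differences are bounded by `2B`, so the total proxy is `N B²`, while `ε² = 2 N B² log
  -- (2/δ)`.
  have e : -ε ^ 2 / (2 * (N * ((2 * B) ^ 2 / 4))) = -Real.log (2 / δ) := by
    rw [hε, mul_pow, mul_pow, Real.sq_sqrt (by positivity)]
    field_simp; ring
  -- The tail is `δ/2`; a one-sided bound leaves half of the budget unspent.
  rw [e, Real.exp_neg, Real.exp_log (by have := hδ.1; positivity), inv_div]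
  linarith [hδ.1]

end Symmetrization

/-! ### Generalization bounds for Lipschitz losses of inner products -/

section Features

variable {Z : Type*} [MeasurableSpace Z]

lemma ae_pi_forall (𝒟 : Measure Z) [IsProbabilityMeasure 𝒟] {N : ℕ} {p : Z → Prop}
    (hp : ∀ᵐ z ∂𝒟, p z) : ∀ᵐ s ∂(Measure.pi fun _ : Fin N => 𝒟), ∀ k, p (s k) :=
  ae_all_iff.mpr fun k =>
    (measurePreserving_eval (fun _ : Fin N => 𝒟) k).quasiMeasurePreserving.ae hp

/-- The generalization gap of a bounded function is at most twice the bound. -/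
lemma gap_le_two_mul (𝒟 : Measure Z) [IsProbabilityMeasure 𝒟] {N : ℕ} (hN : 0 < N) {f : Z → ℝ}
    {B : ℝ} (hf : ∀ᵐ z ∂𝒟, |f z| ≤ B) {s : Fin N → Z} (hs : ∀ k, |f (s k)| ≤ B) :
    ∫ z, f z ∂𝒟 - 1 / (N : ℝ) * ∑ k, f (s k) ≤ 2 * B := by
  have hN' : (0 : ℝ) < N := Nat.cast_pos.mpr hN
  have h1 : |∫ z, f z ∂𝒟| ≤ B := by
    simpa using norm_integral_le_of_norm_le_const (μ := 𝒟) (C := B) (f := f) hf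
  have h2 : -(N * B) ≤ ∑ k, f (s k) := by
    calc -(N * B) = ∑ _k : Fin N, -B := by simp
      _ ≤ ∑ k, f (s k) := Finset.sum_le_sum fun k _ => (abs_le.mp (hs k)).1
  have h3 : -B ≤ 1 / (N : ℝ) * ∑ k, f (s k) := by
    calc -B = 1 / (N : ℝ) * -(N * B) := by field_simp
      _ ≤ _ := by gcongr
  linarith [(abs_le.mp h1).2]

lemma bound_nonneg_of_ae {𝒟 : Measure Z} [IsProbabilityMeasure 𝒟] {f : Z → ℝ} {B : ℝ}
    (hf : ∀ᵐ z ∂𝒟, |f z| ≤ B) : 0 ≤ B := by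
  obtain ⟨z, hz⟩ := hf.exists
  exact (abs_nonneg _).trans hz

variable {H : Type*} [NormedAddCommGroup H] [InnerProductSpace ℝ H] {Ψ : Type*} [Fintype Ψ]
  {ℓ : ℝ → ℝ → ℝ} {K : ℝ}

lemma lipschitz_const_nonneg
    (hLip : ∀ a a' b b' : ℝ, |ℓ a b - ℓ a' b'| ≤ K * (|a - a'| + |b - b'|)) : 0 ≤ K := by
  have := (abs_nonneg _).trans (hLip 1 0 0 0)
  simpa using this

lemma continuous_loss
    (hLip : ∀ a a' b b' : ℝ, |ℓ a b - ℓ a' b'| ≤ K * (|a - a'| + |b - b'|)) :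
    Continuous fun q : ℝ × ℝ => ℓ q.1 q.2 := by
  refine continuous_iff_continuousAt.mpr fun q => ?_
  rw [ContinuousAt, tendsto_iff_norm_sub_tendsto_zero]
  refine squeeze_zero (fun _ => norm_nonneg _) (fun p => hLip p.1 q.1 p.2 q.2) ?_
  have : Continuous fun p : ℝ × ℝ => K * (|p.1 - q.1| + |p.2 - q.2|) := by fun_prop
  simpa using this.tendsto q

/-- The empirical Rademacher average of a finite union of images of balls of a Hilbert space,
composed with a Lipschitz loss. -/
lemma sum_iSup_rademacher_loss_le {ι : Type*} [Finite ι] [Nonempty ι] {N : ℕ} (w : ι → H)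
    (ψ : ι → Ψ) (φ : Ψ → Fin N → H) {c r : ℝ} (hc : 0 ≤ c) (hw : ∀ i, ‖w i‖ ≤ c) (hr : 0 ≤ r)
    (hφ : ∀ p k, ‖φ p k‖ ≤ r) (y : Fin N → ℝ)
    (hLip : ∀ a a' b b' : ℝ, |ℓ a b - ℓ a' b'| ≤ K * (|a - a'| + |b - b'|)) :
    ∑ σ : Fin N → Bool, ⨆ i, ∑ k, boolSign (σ k) * ℓ (inner ℝ (w i) (φ (ψ i) k)) (y k)
      ≤ 2 ^ N * (Fintype.card Ψ * K * c * r * √N) := by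
  have hK := lipschitz_const_nonneg hLip
  have h1 := sum_iSup_rademacher_contraction (fun _ : ι => (0 : ℝ))
    (fun i k => inner ℝ (w i) (φ (ψ i) k)) (fun k a => ℓ a (y k)) K
    (fun k a a' => by simpa using hLip a a' (y k) (y k))
  simp only [zero_add] at h1
  refine h1.trans ?_
  -- Cauchy-Schwarz removes `w i`. The maximum over the remaining choice `ψ i` is bounded by the sum
  -- over `Ψ`, which is where the cardinality factor arises.
  have h2 : ∀ σ : Fin N → Bool, ⨆ i, ∑ k, boolSign (σ k) * (K * inner ℝ (w i) (φ (ψ i) k))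
      ≤ ∑ p, K * c * ‖∑ k, boolSign (σ k) • φ p k‖ := fun σ => by
    refine ciSup_le fun i => ?_
    have e : ∑ k, boolSign (σ k) * (K * inner ℝ (w i) (φ (ψ i) k))
        = K * inner ℝ (w i) (∑ k, boolSign (σ k) • φ (ψ i) k) := by
      rw [inner_sum, Finset.mul_sum]
      refine Finset.sum_congr rfl fun k _ => ?_
      rw [inner_smul_right]; ring
    rw [e]
    refine le_trans ?_ (Finset.single_le_sum (f := fun p => K * c * ‖∑ k, boolSign (σ k) • φ p k‖)
      (fun p _ => by positivity) (Finset.mem_univ (ψ i)))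
    rw [mul_assoc]
    refine mul_le_mul_of_nonneg_left ((real_inner_le_norm _ _).trans ?_) hK
    exact mul_le_mul_of_nonneg_right (hw i) (norm_nonneg _)
  refine (Finset.sum_le_sum fun σ _ => h2 σ).trans ?_
  rw [Finset.sum_comm]
  calc ∑ p, ∑ σ : Fin N → Bool, K * c * ‖∑ k, boolSign (σ k) • φ p k‖
      ≤ ∑ _p : Ψ, K * c * (2 ^ N * (√N * r)) := Finset.sum_le_sum fun p _ => by
        rw [← Finset.mul_sum]
        exact mul_le_mul_of_nonneg_left (sum_norm_rademacher_le (φ p) hr (hφ p)) (by positivity)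
    _ = _ := by simp; ring

/-- The generalization bound for finitely many functions of the form
`z ↦ ℓ (⟪wᵢ, φ_{ψ i}(z)⟫, Y z)`. -/
lemma measure_pi_gap_features_le_of_finite (𝒟 : Measure Z) [IsProbabilityMeasure 𝒟] {ι : Type*}
    [Finite ι] [Nonempty ι] (w : ι → H) (ψ : ι → Ψ) (φ : Ψ → Z → H)
    (hm : ∀ i, AEMeasurable (fun z => inner ℝ (w i) (φ (ψ i) z) : Z → ℝ) 𝒟) {c r : ℝ} (hc : 0 ≤ c)
    (hw : ∀ i, ‖w i‖ ≤ c) (hr : 0 ≤ r) (hφ : ∀ᵐ z ∂𝒟, ∀ p, ‖φ p z‖ ≤ r)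
    (hLip : ∀ a a' b b' : ℝ, |ℓ a b - ℓ a' b'| ≤ K * (|a - a'| + |b - b'|))
    {Y : Z → ℝ} (hY : AEMeasurable Y 𝒟) {B : ℝ}
    (hB : ∀ᵐ z ∂𝒟, ∀ i, |ℓ (inner ℝ (w i) (φ (ψ i) z)) (Y z)| ≤ B) {N : ℕ} (hN : 0 < N)
    {δ : ℝ} (hδ : δ ∈ Ioo (0 : ℝ) 1) :
    (Measure.pi fun _ : Fin N => 𝒟)
      {s | ∃ i, 2 * (Fintype.card Ψ * K * c * r * √N) / N + B * √(2 * Real.log (2 / δ) / N)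
        < ∫ z, ℓ (inner ℝ (w i) (φ (ψ i) z)) (Y z) ∂𝒟
          - 1 / (N : ℝ) * ∑ k, ℓ (inner ℝ (w i) (φ (ψ i) (s k))) (Y (s k))}
      ≤ ENNReal.ofReal δ := by
  set a : ι → Z → ℝ := fun i z => ℓ (inner ℝ (w i) (φ (ψ i) z)) (Y z) with ha
  have hK := lipschitz_const_nonneg hLip
  have hB0 : 0 ≤ B := bound_nonneg_of_ae (f := a (Classical.arbitrary ι)) (hB.mono fun z h => h _)
  -- For `B = 0` the McDiarmid exponent degenerates to `0/0`, but then all losses vanish almost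
  -- surely and so does the gap.
  rcases hB0.eq_or_lt with rfl | hBpos
  · refine le_trans (le_of_eq ?_) zero_le
    refine measure_mono_null ?_ (ae_pi_forall (N := N) 𝒟 hB)
    rintro s ⟨i, hi⟩ hs
    have := gap_le_two_mul 𝒟 hN (f := a i) (hB.mono fun z h => h i) (fun k => hs k i)
    have h0 : 0 ≤ 2 * (Fintype.card Ψ * K * c * r * √N) / N := by positivity
    simp only [ha] at this
    linarith
  have ham : ∀ i, AEMeasurable (a i) 𝒟 := fun i =>
    (continuous_loss hLip).measurable.comp_aemeasurable ((hm i).prodMk hY)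
  -- A measurable modification clipped to `[-B, B]` is measurable and bounded everywhere, and almost
  -- everywhere equal to the loss.
  set f : ι → Z → ℝ := fun i z => max (-B) (min B ((ham i).mk (a i) z)) with hf
  have hfm : ∀ i, Measurable (f i) := fun i =>
    measurable_const.max (measurable_const.min (ham i).measurable_mk)
  have hfB : ∀ i z, |f i z| ≤ B := fun i z => abs_le.mpr
    ⟨le_max_left _ _, max_le (by linarith) (min_le_left _ _)⟩
  have hfa : ∀ᵐ z ∂𝒟, ∀ i, f i z = a i z := by
    filter_upwards [hB, ae_all_iff.mpr fun i => (ham i).ae_eq_mk] with z hz hz' i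
    have := abs_le.mp (hz i)
    rw [hf]; simp only
    rw [← hz' i, min_eq_right this.2, max_eq_right this.1]
  have key := measure_pi_gap_le (N := N) 𝒟 hfm hfB hBpos hN
    (R := Fintype.card Ψ * K * c * r * √N) (by
      filter_upwards [ae_pi_forall 𝒟 hfa, ae_pi_forall 𝒟 hφ] with s hs hs'
      have := sum_iSup_rademacher_loss_le w ψ (fun p k => φ p (s k)) hc hw hr
        (fun p k => hs' k p) (fun k => Y (s k)) hLip
      simpa only [radSup, hs] using this) hδ
  refine (measure_mono_ae ?_).trans key
  filter_upwards [ae_pi_forall 𝒟 hfa] with s hs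
  rintro ⟨i, hi⟩
  refine ⟨i, ?_⟩
  rw [integral_congr_ae (hfa.mono fun z h => h i)]
  simpa only [hs] using hi

/-- The generalization bound for arbitrarily many functions of the form
`z ↦ ℓ (⟪wᵢ, φ_{ψ i}(z)⟫, Y z)`, with values of `ψ` in a finite set. -/
lemma measure_pi_gap_features_le [SecondCountableTopology H] (𝒟 : Measure Z)
    [IsProbabilityMeasure 𝒟] {ι : Type*} (w : ι → H) (ψ : ι → Ψ) (φ : Ψ → Z → H)
    (hm : ∀ i, AEMeasurable (fun z => inner ℝ (w i) (φ (ψ i) z) : Z → ℝ) 𝒟) {c r : ℝ} (hc : 0 ≤ c)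
    (hw : ∀ i, ‖w i‖ ≤ c) (hr : 0 ≤ r) (hφ : ∀ᵐ z ∂𝒟, ∀ p, ‖φ p z‖ ≤ r)
    (hLip : ∀ a a' b b' : ℝ, |ℓ a b - ℓ a' b'| ≤ K * (|a - a'| + |b - b'|))
    {Y : Z → ℝ} (hY : AEMeasurable Y 𝒟) {B : ℝ}
    (hB : ∀ᵐ z ∂𝒟, ∀ i, |ℓ (inner ℝ (w i) (φ (ψ i) z)) (Y z)| ≤ B) {N : ℕ} (hN : 0 < N)
    {δ : ℝ} (hδ : δ ∈ Ioo (0 : ℝ) 1) :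
    (Measure.pi fun _ : Fin N => 𝒟)
      {s | ∃ i, 2 * (Fintype.card Ψ * K * c * r * √N) / N + B * √(2 * Real.log (2 / δ) / N)
        < ∫ z, ℓ (inner ℝ (w i) (φ (ψ i) z)) (Y z) ∂𝒟
          - 1 / (N : ℝ) * ∑ k, ℓ (inner ℝ (w i) (φ (ψ i) (s k))) (Y (s k))}
      ≤ ENNReal.ofReal δ := by
  rcases isEmpty_or_nonempty ι with hι | hι
  · simp
  have hK := lipschitz_const_nonneg hLip
  have hN' : (0 : ℝ) < N := Nat.cast_pos.mpr hN
  set a : ι → Z → ℝ := fun i z => ℓ (inner ℝ (w i) (φ (ψ i) z)) (Y z) with ha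
  set R := 2 * (Fintype.card Ψ * K * c * r * √N) / N + B * √(2 * Real.log (2 / δ) / N)
  have ham : ∀ i, AEMeasurable (a i) 𝒟 := fun i =>
    (continuous_loss hLip).measurable.comp_aemeasurable ((hm i).prodMk hY)
  have hai : ∀ i, Integrable (a i) 𝒟 := fun i =>
    Integrable.of_bound (ham i).aestronglyMeasurable B (hB.mono fun z h => h i)
  let _ : TopologicalSpace Ψ := ⊥
  have : DiscreteTopology Ψ := ⟨rfl⟩
  -- Indices are close when their weights are close and their labels in `Ψ` coincide. This topology
  -- is second countable, which provides a dense sequence of indices.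
  let _ : TopologicalSpace ι := TopologicalSpace.induced (fun i => (w i, ψ i)) inferInstance
  have : SecondCountableTopology ι := TopologicalSpace.secondCountableTopology_induced _ _ _
  have hcont : Continuous fun i => (w i, ψ i) := continuous_induced_dom
  set e := TopologicalSpace.denseSeq ι
  have hdense : ∀ i, ∀ ε > 0, ∃ n, ψ (e n) = ψ i ∧ ‖w (e n) - w i‖ < ε := fun i ε hε => by
    have ho : IsOpen ((fun i => (w i, ψ i)) ⁻¹' (Metric.ball (w i) ε ×ˢ {ψ i})) :=
      (Metric.isOpen_ball.prod (isOpen_discrete _)).preimage hcont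
    obtain ⟨n, hn⟩ := (TopologicalSpace.denseRange_denseSeq ι).exists_mem_open ho
      ⟨i, by simpa using hε⟩
    simp only [Set.mem_preimage, Set.mem_prod, Metric.mem_ball, dist_eq_norm,
      Set.mem_singleton_iff] at hn
    exact ⟨n, hn.2, hn.1⟩
  -- The bad events of the first `n + 1` dense indices increase with `n`, so the uniform bound `δ`
  -- passes to their union by continuity from below.
  set E : ℕ → Set (Fin N → Z) := fun n => {s | ∃ m : Fin (n + 1),
    R < ∫ z, a (e m) z ∂𝒟 - 1 / (N : ℝ) * ∑ k, a (e m) (s k)}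
  have hE : ∀ n, (Measure.pi fun _ : Fin N => 𝒟) (E n) ≤ ENNReal.ofReal δ := fun n =>
    measure_pi_gap_features_le_of_finite 𝒟 (fun m : Fin (n + 1) => w (e m)) (fun m => ψ (e m)) φ
      (fun m => hm _) hc (fun m => hw _) hr hφ hLip hY (hB.mono fun z h m => h _) hN hδ
  have hmono : Monotone E := fun n n' hnn s ⟨m, hm⟩ => ⟨⟨m, by omega⟩, hm⟩
  have hU : (Measure.pi fun _ : Fin N => 𝒟) (⋃ n, E n) ≤ ENNReal.ofReal δ := by
    rw [hmono.measure_iUnion]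
    exact iSup_le hE
  refine (measure_mono_ae ?_).trans hU
  filter_upwards [ae_pi_forall 𝒟 hφ] with s hs
  rintro ⟨i, hi⟩
  set g : ℝ := ∫ z, a i z ∂𝒟 - 1 / (N : ℝ) * ∑ k, a i (s k) with hg
  have hgap : 0 < g - R := by have : R < g := hi; linarith
  -- With this tolerance the loss changes by at most a quarter of the excess `g - R`. Mean and
  -- empirical mean together then lose at most half of it, and the dense index still violates the
  -- bound. The `+ 1` covers `K * r = 0`.
  obtain ⟨n, hn, hn'⟩ := hdense i ((g - R) / (4 * (K * r + 1))) (by positivity)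
  have hclose : ∀ z, (∀ p, ‖φ p z‖ ≤ r) → |a (e n) z - a i z| ≤ (g - R) / 4 := fun z hz => by
    have h1 := hLip (inner ℝ (w (e n)) (φ (ψ i) z)) (inner ℝ (w i) (φ (ψ i) z)) (Y z) (Y z)
    simp only [ha, hn]
    refine h1.trans ?_
    rw [sub_self, abs_zero, add_zero, ← inner_sub_left]
    calc K * |inner ℝ (w (e n) - w i) (φ (ψ i) z)|
        ≤ K * ((g - R) / (4 * (K * r + 1)) * r) := by
          refine mul_le_mul_of_nonneg_left ((abs_real_inner_le_norm _ _).trans ?_) hK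
          gcongr
          exact hz _
      _ ≤ (g - R) / 4 := by
          have : 0 ≤ K * r := by positivity
          rw [div_mul_eq_mul_div, mul_div_assoc', div_le_div_iff₀ (by positivity) (by positivity)]
          nlinarith
  refine Set.mem_iUnion.mpr ⟨n, ⟨n, by omega⟩, ?_⟩
  have h1 : ∫ z, a i z ∂𝒟 - ∫ z, a (e n) z ∂𝒟 ≤ (g - R) / 4 := by
    rw [← integral_sub (hai _) (hai _)]
    have := integral_mono_ae ((hai i).sub (hai (e n))) (integrable_const ((g - R) / 4))
      (hφ.mono fun z hz => by have := abs_le.mp (hclose z hz); simp only [Pi.sub_apply]; linarith)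
    simpa using this
  have h2 : 1 / (N : ℝ) * ∑ k, a (e n) (s k) - 1 / (N : ℝ) * ∑ k, a i (s k) ≤ (g - R) / 4 := by
    rw [← mul_sub, ← Finset.sum_sub_distrib]
    calc 1 / (N : ℝ) * ∑ k, (a (e n) (s k) - a i (s k))
        ≤ 1 / (N : ℝ) * ∑ _k : Fin N, (g - R) / 4 := by
          gcongr with k
          exact (abs_le.mp (hclose _ (hs k))).2
      _ = (g - R) / 4 := by simp; field_simp
  simp only
  linarith

end Features

/-! ### Operator flow and variation of constants -/

section Duhamel

variable {E : Type*} [NormedAddCommGroup E] [NormedSpace ℝ E]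

/-- The flow `e^{tA}` of a bounded operator. -/
def opFlow (A : E →L[ℝ] E) (t : ℝ) : E →L[ℝ] E := NormedSpace.exp (t • A)

lemma AEStronglyMeasurable.clm_apply_fun {α : Type*} [MeasurableSpace α] {μ : Measure α}
    {L : α → E →L[ℝ] E} {v : α → E} (hL : AEStronglyMeasurable L μ)
    (hv : AEStronglyMeasurable v μ) : AEStronglyMeasurable (fun a => L a (v a)) μ :=
  isBoundedBilinearMap_apply.continuous.comp_aestronglyMeasurable (hL.prodMk hv)

variable [CompleteSpace E] (A : E →L[ℝ] E)

@[simp] lemma opFlow_zero : opFlow A 0 = 1 := by simp [opFlow]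

lemma hasDerivAt_opFlow (t : ℝ) : HasDerivAt (opFlow A) (opFlow A t * A) t :=
  hasDerivAt_exp_smul_const A t

lemma continuous_opFlow : Continuous (opFlow A) :=
  continuous_iff_continuousAt.mpr fun t => (hasDerivAt_opFlow A t).continuousAt

lemma exists_opFlow_bound (T : ℝ) : ∃ C, 0 ≤ C ∧ ∀ t ∈ Icc 0 T, ‖opFlow A t‖ ≤ C := by
  obtain ⟨C, hC⟩ := isCompact_Icc.exists_bound_of_continuousOn
    (continuous_opFlow A).continuousOn (s := Icc 0 T)
  exact ⟨max C 0, le_max_right _ _, fun t ht => (hC t ht).trans (le_max_left _ _)⟩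

lemma integral_opFlow_apply (v : E) (r t : ℝ) :
    ∫ s in r..t, opFlow A (t - s) (A v) = opFlow A (t - r) v - v := by
  have hd : ∀ s ∈ uIcc r t, HasDerivAt (fun s => -(opFlow A (t - s) v))
      (opFlow A (t - s) (A v)) s := fun s _ => by
    have h1 : HasDerivAt (fun s => opFlow A (t - s)) (-(opFlow A (t - s) * A)) s := by
      simpa using (hasDerivAt_opFlow A (t - s)).comp_const_sub t s
    have h2 := (h1.clm_apply (hasDerivAt_const s v)).neg
    simp only [neg_apply, map_zero, add_zero, neg_neg,
      mul_apply_eq_comp] at h2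
    exact h2
  rw [intervalIntegral.integral_eq_sub_of_hasDerivAt hd]
  · simp only [sub_self, opFlow_zero, one_apply_eq_self]; abel
  · have : Continuous fun s => opFlow A (t - s) (A v) :=
      ((continuous_opFlow A).comp (continuous_const.sub continuous_id)).clm_apply continuous_const
    exact this.intervalIntegrable _ _

/-- The variation of constants formula for an absolutely continuous solution. -/
lemma duhamel {x g : ℝ → E} {t : ℝ} (ht : 0 ≤ t) (hg : IntegrableOn g (Ioc 0 t))
    (hx : IntegrableOn x (Ioc 0 t))
    (h : ∀ s ∈ Icc 0 t, x s = ∫ r in (0 : ℝ)..s, (A (x r) + g r)) :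
    x t = ∫ s in (0 : ℝ)..t, opFlow A (t - s) (g s) := by
  obtain ⟨C, hC0, hC⟩ := exists_opFlow_bound A t
  set μ : Measure ℝ := volume.restrict (Ioc 0 t) with hμ
  have hAx : Integrable (fun r => A (x r)) μ := A.integrable_comp hx
  have hg : Integrable g μ := hg
  set v : ℝ → E := fun r => A (x r) + g r with hv
  have hvi : Integrable v μ := hAx.add hg
  have hflow : Continuous fun s => opFlow A (t - s) :=
    (continuous_opFlow A).comp (continuous_const.sub continuous_id)
  have hCμ : ∀ᵐ s ∂μ, ‖opFlow A (t - s)‖ ≤ C := by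
    filter_upwards [ae_restrict_mem measurableSet_Ioc] with s hs
    exact hC _ ⟨by linarith [hs.2], by linarith [hs.1]⟩
  have hfi : ∀ {w : ℝ → E}, Integrable w μ → Integrable (fun s => opFlow A (t - s) (w s)) μ :=
    fun {w} hw => by
      refine Integrable.mono' (hw.norm.const_mul C)
        (AEStronglyMeasurable.clm_apply_fun hflow.aestronglyMeasurable hw.1) ?_
      filter_upwards [hCμ] with s hs
      exact (ContinuousLinearMap.le_opNorm _ _).trans (by gcongr)
  -- Fubini is applied to `e^{(t-s)A} A v(r)` on `r ≤ s`, where `v` is the derivative of `x`.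
  -- Integrating over `r` first gives `e^{(t-s)A} A x(s)`, and over `s` first `e^{(t-r)A} v(r) -
  -- v(r)`. Comparing the two needs no pointwise differentiability of `x`.
  set k : ℝ → ℝ → E := fun s r =>
    {q : ℝ × ℝ | q.2 ≤ q.1}.indicator (fun q => opFlow A (t - q.1) (A (v q.2))) (s, r) with hk
  have hki : Integrable (Function.uncurry k) (μ.prod μ) := by
    refine Integrable.mono' (g := fun q : ℝ × ℝ => C * ‖A‖ * ‖v q.2‖)
      ((hvi.norm.const_mul (C * ‖A‖)).comp_snd μ) ?_ ?_
    · refine AEStronglyMeasurable.indicator ?_ (measurableSet_le measurable_snd measurable_fst)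
      exact AEStronglyMeasurable.clm_apply_fun
        (hflow.comp continuous_fst).aestronglyMeasurable
        (A.continuous.comp_aestronglyMeasurable hvi.1.comp_snd)
    · have h1 : ∀ᵐ q ∂(μ.prod μ), ‖opFlow A (t - q.1)‖ ≤ C :=
        Measure.quasiMeasurePreserving_fst.ae hCμ
      filter_upwards [h1] with q hq
      refine (norm_indicator_le_norm_self (fun q : ℝ × ℝ => opFlow A (t - q.1) (A (v q.2)))
        q).trans ?_
      refine (ContinuousLinearMap.le_opNorm _ _).trans ?_
      rw [mul_assoc]
      gcongr
      exact A.le_opNorm _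
  have hswap := integral_integral_swap hki
  have hL : ∀ s ∈ Ioc 0 t, ∫ r, k s r ∂μ = opFlow A (t - s) (A (x s)) := fun s hs => by
    have e1 : ∀ r, k s r = (Iic s).indicator (fun r => opFlow A (t - s) (A (v r))) r := fun r => by
      simp only [hk, Set.indicator_apply, Set.mem_ofPred_eq, Set.mem_Iic]
    simp only [e1]
    rw [integral_indicator measurableSet_Iic, hμ, Measure.restrict_restrict measurableSet_Iic,
      show Iic s ∩ Ioc 0 t = Ioc 0 s from by
        ext r; simp only [Set.mem_inter_iff, Set.mem_Iic, Set.mem_Ioc]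
        exact ⟨fun h => ⟨h.2.1, h.1⟩, fun h => ⟨h.2, h.1, h.2.trans hs.2⟩⟩]
    have hvs : IntegrableOn v (Ioc 0 s) := hvi.mono_measure
      (Measure.restrict_mono (Ioc_subset_Ioc_right hs.2) le_rfl)
    rw [← ContinuousLinearMap.comp_apply, h s ⟨hs.1.le, hs.2⟩,
      intervalIntegral.integral_of_le hs.1.le, ← ContinuousLinearMap.integral_comp_comm _ hvs]
    rfl
  have hR : ∀ r ∈ Ioc 0 t, ∫ s, k s r ∂μ = opFlow A (t - r) (v r) - v r := fun r hr => by
    have e1 : ∀ s, k s r = (Ici r).indicator (fun s => opFlow A (t - s) (A (v r))) s := fun s => by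
      simp only [hk, Set.indicator_apply, Set.mem_ofPred_eq, Set.mem_Ici]
    simp only [e1]
    rw [integral_indicator measurableSet_Ici, hμ, Measure.restrict_restrict measurableSet_Ici,
      show Ici r ∩ Ioc 0 t = Icc r t from by
        ext s; simp only [Set.mem_inter_iff, Set.mem_Ici, Set.mem_Ioc, Set.mem_Icc]
        exact ⟨fun h => ⟨h.1, h.2.2⟩, fun h => ⟨h.1, hr.1.trans_le h.1, h.2⟩⟩,
      integral_Icc_eq_integral_Ioc, ← intervalIntegral.integral_of_le hr.2,
      integral_opFlow_apply]
  rw [setIntegral_congr_fun measurableSet_Ioc hL, setIntegral_congr_fun measurableSet_Ioc hR,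
    integral_sub (hfi hvi) hvi] at hswap
  have hx' : x t = ∫ r, v r ∂μ := by
    rw [h t ⟨ht, le_rfl⟩, intervalIntegral.integral_of_le ht]
  have hsplit : ∫ r, opFlow A (t - r) (v r) ∂μ
      = ∫ r, opFlow A (t - r) (A (x r)) ∂μ + ∫ r, opFlow A (t - r) (g r) ∂μ := by
    rw [← integral_add (hfi hAx) (hfi hg)]
    simp only [hv, map_add]
  rw [intervalIntegral.integral_of_le ht]
  rw [hsplit, ← hx'] at hswap
  exact add_left_cancel (eq_sub_iff_add_eq.mp hswap)

end Duhamel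

/-! ### One convolution step in elapsed-time coordinates -/

section VolterraStep

/-- For each fixed second component the first is merely reflected and translated, which preserves
Lebesgue measure. -/
lemma measurePreserving_shear {β : Type*} [MeasurableSpace β] (ν : Measure β) [SFinite ν]
    {c : β → ℝ} (hc : Measurable c) :
    MeasurePreserving (fun q : ℝ × β => (c q.2 - q.1, q.2)) (volume.prod ν) (volume.prod ν) := by
  have h : MeasurePreserving (fun q : β × ℝ => (q.1, c q.1 - q.2)) (ν.prod volume)
      (ν.prod volume) := by
    refine (MeasurePreserving.id ν).skew_product (g := fun b r => c b - r) ?_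
      (ae_of_all _ fun b => (Measure.measurePreserving_sub_left volume (c b)).map_eq)
    exact (hc.comp measurable_fst).sub measurable_snd
  exact Measure.measurePreserving_swap.comp (h.comp Measure.measurePreserving_swap)

/-- Split off the last time of a tuple and turn it into a reflected and shifted time. -/
def splitLast {m : ℕ} (c : (Fin m → ℝ) → ℝ) (t : ℝ) (τ : Fin (m + 1) → ℝ) : ℝ × (Fin m → ℝ) :=
  (t + c (Fin.init τ) - τ (Fin.last m), Fin.init τ)

lemma measurePreserving_splitLast {m : ℕ} {c : (Fin m → ℝ) → ℝ} (hc : Measurable c) (t : ℝ) :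
    MeasurePreserving (splitLast c t) volume (volume.prod volume) := by
  have h1 := volume_preserving_piFinSuccAbove (fun _ : Fin (m + 1) => ℝ) (Fin.last m)
  have h2 := (measurePreserving_shear (volume : Measure (Fin m → ℝ))
    (c := fun b => t + c b) (hc.const_add t)).comp h1
  have e : splitLast c t = (fun q : ℝ × (Fin m → ℝ) => (t + c q.2 - q.1, q.2)) ∘
      MeasurableEquiv.piFinSuccAbove (fun _ : Fin (m + 1) => ℝ) (Fin.last m) := by
    funext τ
    simp [splitLast, MeasurableEquiv.piFinSuccAbove, Fin.insertNthEquiv, Fin.removeNth_last]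
  rw [e]; exact h2

lemma measurePreserving_prod_splitLast {m : ℕ} {c : (Fin m → ℝ) → ℝ} (hc : Measurable c) :
    MeasurePreserving (fun q : ℝ × (Fin (m + 1) → ℝ) => (q.1, splitLast c q.1 q.2))
      (volume.prod volume) (volume.prod (volume.prod volume)) := by
  refine (MeasurePreserving.id (volume : Measure ℝ)).skew_product (g := splitLast c) ?_
      (ae_of_all _ fun t => (measurePreserving_splitLast hc t).map_eq)
  have hi : Measurable fun q : ℝ × (Fin (m + 1) → ℝ) => (Fin.init q.2 : Fin m → ℝ) :=
    measurable_pi_lambda _ fun i => (measurable_pi_apply _).comp measurable_snd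
  refine Measurable.prodMk ?_ hi
  exact (measurable_fst.add (hc.comp hi)).sub ((measurable_pi_apply _).comp measurable_snd)

variable {E : Type*} [NormedAddCommGroup E] [NormedSpace ℝ E] [CompleteSpace E]
  (A : E →L[ℝ] E) {m : ℕ} {H : ℝ × (Fin m → ℝ) → E} {T : ℝ}

/-- The integrand of `∫₀ᵗ e^{(t-s)A} H(s) ds`, on the whole line. -/
def flowIntegrand {β : Type*} (H : ℝ × β → E) (t : ℝ) (q : ℝ × β) : E :=
  (Iic t).indicator (fun s => opFlow A (t - s) (H (s, q.2))) q.1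

lemma norm_flowIntegrand_le {C : ℝ} (hC0 : 0 ≤ C) (hC : ∀ t ∈ Icc 0 T, ‖opFlow A t‖ ≤ C)
    (hH0 : ∀ q, q.1 ∉ Icc 0 T → H q = 0) {t : ℝ} (ht : t ≤ T) (q : ℝ × (Fin m → ℝ)) :
    ‖flowIntegrand A H t q‖ ≤ C * ‖H q‖ := by
  unfold flowIntegrand
  by_cases hq : q.1 ∈ Icc 0 T
  · by_cases hqt : q.1 ≤ t
    · rw [Set.indicator_of_mem (by exact hqt)]
      refine (ContinuousLinearMap.le_opNorm _ _).trans ?_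
      gcongr
      exact hC _ ⟨by linarith, by linarith [hq.1]⟩
    · rw [Set.indicator_of_notMem (by exact hqt), norm_zero]
      positivity
  · have : H (q.1, q.2) = 0 := hH0 q hq
    rw [Set.indicator_apply, this]
    simp only [map_zero, ite_self, norm_zero]
    positivity

lemma integrable_flowIntegrand (hH : Integrable H (volume.prod volume))
    (hH0 : ∀ q, q.1 ∉ Icc 0 T → H q = 0) {t : ℝ} (ht : t ≤ T) :
    Integrable (flowIntegrand A H t) (volume.prod volume) := by
  obtain ⟨C, hC0, hC⟩ := exists_opFlow_bound A T
  refine Integrable.mono' (hH.norm.const_mul C) ?_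
    (ae_of_all _ (norm_flowIntegrand_le A hC0 hC hH0 ht))
  have : flowIntegrand A H t = {q : ℝ × (Fin m → ℝ) | q.1 ≤ t}.indicator
      (fun q => opFlow A (t - q.1) (H q)) := by
    ext q; simp [flowIntegrand, Set.indicator_apply]
  rw [this]
  refine AEStronglyMeasurable.indicator ?_ (measurableSet_le measurable_fst measurable_const)
  exact AEStronglyMeasurable.clm_apply_fun ((continuous_opFlow A).comp
    (continuous_const.sub continuous_fst)).aestronglyMeasurable hH.1

lemma integral_flowIntegrand (hH : Integrable H (volume.prod volume))
    (hH0 : ∀ q, q.1 ∉ Icc 0 T → H q = 0) {t : ℝ} (ht : t ∈ Icc 0 T) :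
    IntervalIntegrable (fun s => opFlow A (t - s) (∫ b, H (s, b))) volume 0 t ∧
    ∫ q, flowIntegrand A H t q ∂(volume.prod volume)
      = ∫ s in (0 : ℝ)..t, opFlow A (t - s) (∫ b, H (s, b)) := by
  have hi := integrable_flowIntegrand A hH hH0 ht.2
  have hfib : ∀ᵐ s, ∫ b, flowIntegrand A H t (s, b)
      = (Ioc 0 t).indicator (fun s => opFlow A (t - s) (∫ b, H (s, b))) s := by
    -- `H` may be nonzero at `s = 0`, which `Ioc 0 t` leaves out; the point is null.
    have h0 : ∀ᵐ s : ℝ, s ≠ 0 := by simp [ae_iff, measure_singleton]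
    filter_upwards [hH.prod_right_ae, h0] with s hs hs0
    unfold flowIntegrand
    by_cases h1 : s ≤ t
    · simp only [Set.indicator_of_mem (show s ∈ Iic t from h1)]
      rw [ContinuousLinearMap.integral_comp_comm _ hs]
      by_cases h2 : 0 < s
      · rw [Set.indicator_of_mem (show s ∈ Ioc 0 t from ⟨h2, h1⟩)]
      · rw [Set.indicator_of_notMem (show s ∉ Ioc 0 t from fun h => h2 h.1)]
        have : ∀ b, H (s, b) = 0 := fun b => hH0 _ fun h => hs0 (le_antisymm (not_lt.mp h2) h.1)
        simp [this]
    · simp only [Set.indicator_of_notMem (show s ∉ Iic t from h1),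
        Set.indicator_of_notMem (show s ∉ Ioc 0 t from fun h => h1 h.2), integral_zero]
  constructor
  · rw [intervalIntegrable_iff_integrableOn_Ioc_of_le ht.1,
      ← integrable_indicator_iff measurableSet_Ioc]
    exact hi.integral_prod_left.congr hfib
  · rw [integral_prod _ hi, integral_congr_ae hfib, integral_indicator measurableSet_Ioc,
      intervalIntegral.integral_of_le ht.1]

lemma integral_flowIntegrand_splitLast {c : (Fin m → ℝ) → ℝ} (hc : Measurable c)
    (hH : Integrable H (volume.prod volume))
    (hH0 : ∀ q, q.1 ∉ Icc 0 T → H q = 0) {t : ℝ} (ht : t ∈ Icc 0 T) :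
    Integrable (fun τ => flowIntegrand A H t (splitLast c t τ)) ∧
    ∫ τ, flowIntegrand A H t (splitLast c t τ)
      = ∫ s in (0 : ℝ)..t, opFlow A (t - s) (∫ b, H (s, b)) := by
  have hi := integrable_flowIntegrand A hH hH0 ht.2
  have hp := measurePreserving_splitLast hc t
  refine ⟨hp.integrable_comp_of_integrable hi, ?_⟩
  rw [← (integral_flowIntegrand A hH hH0 ht).2, ← hp.map_eq,
    integral_map hp.measurable.aemeasurable (by rw [hp.map_eq]; exact hi.1)]

/-- In the next convolution step `t` itself becomes an integration variable, so integrability must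
hold jointly in `t` and the times. -/
lemma integrable_flowIntegrand_prod_splitLast {c : (Fin m → ℝ) → ℝ} (hc : Measurable c)
    (hH : Integrable H (volume.prod volume)) (hH0 : ∀ q, q.1 ∉ Icc 0 T → H q = 0) :
    Integrable (fun q : ℝ × (Fin (m + 1) → ℝ) =>
      (Icc 0 T).indicator (fun t => flowIntegrand A H t (splitLast c t q.2)) q.1)
      (volume.prod volume) := by
  obtain ⟨C, hC0, hC⟩ := exists_opFlow_bound A T
  set G : ℝ × (ℝ × (Fin m → ℝ)) → E := fun q =>
    (Icc 0 T).indicator (fun t => flowIntegrand A H t q.2) q.1 with hG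
  have hGi : Integrable G (volume.prod (volume.prod volume)) := by
    have hone : Integrable ((Icc 0 T).indicator fun _ : ℝ => C) volume :=
      (integrable_indicator_iff measurableSet_Icc).mpr (by simp)
    refine Integrable.mono' (hone.mul_prod hH.norm) ?_ (ae_of_all _ fun q => ?_)
    · have : G = {q : ℝ × (ℝ × (Fin m → ℝ)) | q.1 ∈ Icc 0 T ∧ q.2.1 ≤ q.1}.indicator
          (fun q => opFlow A (q.1 - q.2.1) (H q.2)) := by
        ext q; simp only [hG, flowIntegrand, Set.indicator_apply, Set.mem_ofPred_eq, Set.mem_Iic]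
        by_cases h1 : q.1 ∈ Icc 0 T <;> by_cases h2 : q.2.1 ≤ q.1 <;> simp [h1, h2]
      rw [this]
      refine AEStronglyMeasurable.indicator ?_ ((measurableSet_Icc.preimage measurable_fst).inter
        (measurableSet_le (measurable_fst.comp measurable_snd) measurable_fst))
      exact AEStronglyMeasurable.clm_apply_fun ((continuous_opFlow A).comp
        (continuous_fst.sub (continuous_fst.comp continuous_snd))).aestronglyMeasurable
        hH.1.comp_snd
    · by_cases h : q.1 ∈ Icc 0 T
      · simp only [hG, Set.indicator_of_mem h]
        exact norm_flowIntegrand_le A hC0 hC hH0 h.2 q.2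
      · simp only [hG, Set.indicator_of_notMem h, norm_zero, zero_mul, le_refl]
  exact (measurePreserving_prod_splitLast hc).integrable_comp_of_integrable hGi

end VolterraStep

/-! ### The Dyson series -/

section Dyson

variable {E : Type*} [NormedAddCommGroup E] [NormedSpace ℝ E]

/-- The integrand of the `k`-th term of the Dyson series of `ẋ = A x + N(t) x + g(t)`. -/
def dysonIntegrand (A : E →L[ℝ] E) (N : ℝ → E →L[ℝ] E) (g : ℝ → E) :
    (k : ℕ) → ℝ → (Fin (k + 1) → ℝ) → E
  | 0, t, τ => flowIntegrand A (fun q : ℝ × (Fin 0 → ℝ) => g q.1) t (splitLast (fun _ => 0) t τ)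
  | k + 1, t, τ => flowIntegrand A (fun q => N q.1 (dysonIntegrand A N g k q.1 q.2)) t
      (splitLast (fun b => b (Fin.last k)) t τ)

/-- The `k`-th term of the Dyson series. -/
def dysonTerm (A : E →L[ℝ] E) (N : ℝ → E →L[ℝ] E) (g : ℝ → E) (k : ℕ) (t : ℝ) : E :=
  ∫ τ, dysonIntegrand A N g k t τ

variable [CompleteSpace E] {A : E →L[ℝ] E} {N : ℝ → E →L[ℝ] E} {g : ℝ → E} {T M : ℝ}

lemma integrable_dyson_input (hg : Integrable g) :
    Integrable (fun q : ℝ × (Fin 0 → ℝ) => g q.1) (volume.prod volume) := hg.comp_fst _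

/-- Since `N` vanishes off `[0,T]`, the indicator carried by the joint integrability can be inserted
for free. -/
lemma integrable_dyson_step (hN : AEStronglyMeasurable N volume) (hNM : ∀ s, ‖N s‖ ≤ M)
    (hN0 : ∀ s, s ∉ Icc 0 T → N s = 0) {k : ℕ}
    (hi : Integrable (fun q : ℝ × (Fin (k + 1) → ℝ) =>
      (Icc 0 T).indicator (fun t => dysonIntegrand A N g k t q.2) q.1) (volume.prod volume)) :
    Integrable (fun q : ℝ × (Fin (k + 1) → ℝ) => N q.1 (dysonIntegrand A N g k q.1 q.2))
      (volume.prod volume) := by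
  have e : (fun q : ℝ × (Fin (k + 1) → ℝ) => N q.1 (dysonIntegrand A N g k q.1 q.2))
      = fun q => N q.1 ((Icc 0 T).indicator (fun t => dysonIntegrand A N g k t q.2) q.1) := by
    funext q
    by_cases h : q.1 ∈ Icc 0 T
    · rw [Set.indicator_of_mem h]
    · simp [hN0 _ h]
  rw [e]
  refine Integrable.mono' (hi.norm.const_mul M)
    (AEStronglyMeasurable.clm_apply_fun hN.comp_fst hi.1) (ae_of_all _ fun q => ?_)
  refine (ContinuousLinearMap.le_opNorm _ _).trans ?_
  gcongr
  exact hNM _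

lemma integrable_dysonIntegrand_prod (hN : AEStronglyMeasurable N volume)
    (hNM : ∀ s, ‖N s‖ ≤ M) (hN0 : ∀ s, s ∉ Icc 0 T → N s = 0) (hg : Integrable g)
    (hg0 : ∀ s, s ∉ Icc 0 T → g s = 0) (k : ℕ) :
    Integrable (fun q : ℝ × (Fin (k + 1) → ℝ) =>
      (Icc 0 T).indicator (fun t => dysonIntegrand A N g k t q.2) q.1) (volume.prod volume) := by
  induction k with
  | zero =>
    exact integrable_flowIntegrand_prod_splitLast A measurable_const (integrable_dyson_input hg)
      fun q hq => hg0 _ hq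
  | succ k ih =>
    exact integrable_flowIntegrand_prod_splitLast A (measurable_pi_apply _)
      (integrable_dyson_step hN hNM hN0 ih) fun q hq => by simp [hN0 _ hq]

lemma integrable_dysonIntegrand (hN : AEStronglyMeasurable N volume)
    (hNM : ∀ s, ‖N s‖ ≤ M) (hN0 : ∀ s, s ∉ Icc 0 T → N s = 0) (hg : Integrable g)
    (hg0 : ∀ s, s ∉ Icc 0 T → g s = 0) (k : ℕ) {t : ℝ} (ht : t ∈ Icc 0 T) :
    Integrable (dysonIntegrand A N g k t) := by
  cases k with
  | zero =>
    exact (integral_flowIntegrand_splitLast A measurable_const (integrable_dyson_input hg)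
      (fun q hq => hg0 _ hq) ht).1
  | succ k =>
    exact (integral_flowIntegrand_splitLast A (measurable_pi_apply _)
      (integrable_dyson_step hN hNM hN0 (integrable_dysonIntegrand_prod hN hNM hN0 hg hg0 k))
      (fun q hq => by simp [hN0 _ hq]) ht).1

lemma dysonTerm_zero (hg : Integrable g) (hg0 : ∀ s, s ∉ Icc 0 T → g s = 0) {t : ℝ}
    (ht : t ∈ Icc 0 T) :
    IntervalIntegrable (fun s => opFlow A (t - s) (g s)) volume 0 t ∧
    dysonTerm A N g 0 t = ∫ s in (0 : ℝ)..t, opFlow A (t - s) (g s) := by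
  have h1 := integral_flowIntegrand A (integrable_dyson_input hg) (fun q hq => hg0 _ hq) ht
  have h2 := integral_flowIntegrand_splitLast A (c := fun _ => 0) measurable_const
    (integrable_dyson_input hg) (fun q hq => hg0 _ hq) ht
  have e : ∀ s, ∫ _b : Fin 0 → ℝ, g s = g s := fun s => by
    rw [integral_const]; simp [Measure.real, volume_pi]
  simp only [e] at h1 h2
  exact ⟨h1.1, h2.2⟩

/-- Undoing the change of times leaves an inner integral through which the bounded operator `N s`
commutes; off `[0,T]` both sides of that commutation are zero. -/
lemma dysonTerm_succ (hN : AEStronglyMeasurable N volume)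
    (hNM : ∀ s, ‖N s‖ ≤ M) (hN0 : ∀ s, s ∉ Icc 0 T → N s = 0) (hg : Integrable g)
    (hg0 : ∀ s, s ∉ Icc 0 T → g s = 0) (k : ℕ) {t : ℝ} (ht : t ∈ Icc 0 T) :
    IntervalIntegrable (fun s => opFlow A (t - s) (N s (dysonTerm A N g k s))) volume 0 t ∧
    dysonTerm A N g (k + 1) t
      = ∫ s in (0 : ℝ)..t, opFlow A (t - s) (N s (dysonTerm A N g k s)) := by
  have hs := integrable_dyson_step hN hNM hN0
    (integrable_dysonIntegrand_prod (A := A) hN hNM hN0 hg hg0 k)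
  have h1 := integral_flowIntegrand A hs (fun q hq => by simp [hN0 _ hq]) ht
  have h2 := integral_flowIntegrand_splitLast A (c := fun b => b (Fin.last k))
    (measurable_pi_apply _) hs (fun q hq => by simp [hN0 _ hq]) ht
  have e : ∀ s, ∫ b, N s (dysonIntegrand A N g k s b) = N s (dysonTerm A N g k s) := fun s => by
    by_cases h : s ∈ Icc 0 T
    · exact ContinuousLinearMap.integral_comp_comm _
        (integrable_dysonIntegrand hN hNM hN0 hg hg0 k h)
    · simp [hN0 _ h]
  simp only [e] at h1 h2
  exact ⟨h1.1, h2.2⟩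

/-- The Dyson series converges to the solution of the integral equation. -/
lemma hasSum_dysonTerm (hN : AEStronglyMeasurable N volume)
    (hNM : ∀ s, ‖N s‖ ≤ M) (hN0 : ∀ s, s ∉ Icc 0 T → N s = 0) (hg : Integrable g)
    (hg0 : ∀ s, s ∉ Icc 0 T → g s = 0) {x : ℝ → E} (hxc : ContinuousOn x (Icc 0 T))
    (hx : ∀ t ∈ Icc 0 T, x t = ∫ s in (0 : ℝ)..t, opFlow A (t - s) (N s (x s) + g s))
    {t : ℝ} (ht : t ∈ Icc 0 T) :
    Tendsto (fun n => ∑ k ∈ Finset.range n, dysonTerm A N g k t) atTop (𝓝 (x t)) := by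
  obtain ⟨C, hC0, hC⟩ := exists_opFlow_bound A T
  obtain ⟨X, hX⟩ := isCompact_Icc.exists_bound_of_continuousOn hxc
  have hM0 : 0 ≤ M := (norm_nonneg _).trans (hNM 0)
  set r : ℕ → ℝ → E := fun n t => x t - ∑ k ∈ Finset.range n, dysonTerm A N g k t with hr
  have hNx : ∀ t ∈ Icc 0 T,
      IntervalIntegrable (fun s => opFlow A (t - s) (N s (x s))) volume 0 t := fun t ht => by
    rw [intervalIntegrable_iff_integrableOn_Ioc_of_le ht.1]
    have hxm : AEStronglyMeasurable x (volume.restrict (Ioc 0 t)) :=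
      (hxc.mono fun s hs => ⟨hs.1.le, hs.2.trans ht.2⟩).aestronglyMeasurable measurableSet_Ioc
    refine IntegrableOn.of_bound (by simp)
      (AEStronglyMeasurable.clm_apply_fun ((continuous_opFlow A).comp
        (continuous_const.sub continuous_id)).aestronglyMeasurable
        (AEStronglyMeasurable.clm_apply_fun hN.restrict hxm)) (C * (M * X)) ?_
    filter_upwards [ae_restrict_mem measurableSet_Ioc] with s hs
    have h1 := hC (t - s) ⟨by linarith [hs.2], by linarith [hs.1, ht.2]⟩
    have h2 := hX s ⟨hs.1.le, hs.2.trans ht.2⟩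
    refine (ContinuousLinearMap.le_opNorm _ _).trans ?_
    gcongr
    exact (ContinuousLinearMap.le_opNorm _ _).trans (by gcongr; exact hNM s)
  -- Subtracting the recursion for the terms from the equation for `x` cancels the forcing, so each
  -- remainder is the Volterra operator applied to the previous one.
  have hrec : ∀ n, ∀ t ∈ Icc 0 T,
      r (n + 1) t = ∫ s in (0 : ℝ)..t, opFlow A (t - s) (N s (r n s)) := fun n t ht => by
    have e1 : x t = (∫ s in (0 : ℝ)..t, opFlow A (t - s) (N s (x s))) + dysonTerm A N g 0 t := by
      rw [hx t ht, (dysonTerm_zero (N := N) hg hg0 ht).2,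
        ← intervalIntegral.integral_add (hNx t ht) (dysonTerm_zero (N := N) hg hg0 ht).1]
      simp only [map_add]
    have e2 : ∑ k ∈ Finset.range n, dysonTerm A N g (k + 1) t = ∫ s in (0 : ℝ)..t,
        ∑ k ∈ Finset.range n, opFlow A (t - s) (N s (dysonTerm A N g k s)) := by
      rw [intervalIntegral.integral_finsetSum fun k _ =>
        (dysonTerm_succ hN hNM hN0 hg hg0 k ht).1]
      exact Finset.sum_congr rfl fun k _ => (dysonTerm_succ hN hNM hN0 hg hg0 k ht).2
    simp only [hr]
    rw [Finset.sum_range_succ', e2, e1, add_sub_add_right_eq_sub,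
      ← intervalIntegral.integral_sub (hNx t ht)]
    · simp only [map_sub, map_sum]
    · have := IntervalIntegrable.sum (Finset.range n) fun k _ =>
        (dysonTerm_succ (A := A) hN hNM hN0 hg hg0 k ht).1
      exact this.congr (fun s _ => by simp)
  have hX0 : 0 ≤ X := (norm_nonneg _).trans (hX t ht)
  -- Picard's estimate: each iteration integrates a power of `s` once more, and the factorial so
  -- produced forces convergence on the compact interval.
  have hbd : ∀ n, ∀ t ∈ Icc 0 T, ‖r n t‖ ≤ X * ((C * M) ^ n * t ^ n / n.factorial) := fun n => by
    induction n with
    | zero => intro t ht; simpa [hr] using hX t ht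
    | succ n ih =>
      intro t ht
      rw [hrec n t ht]
      have hb : ∀ s ∈ Ioc 0 t, ‖opFlow A (t - s) (N s (r n s))‖
          ≤ C * (M * (X * ((C * M) ^ n * s ^ n / n.factorial))) := fun s hs => by
        have h1 := hC (t - s) ⟨by linarith [hs.2], by linarith [hs.1, ht.2]⟩
        have h2 := ih s ⟨hs.1.le, hs.2.trans ht.2⟩
        refine (ContinuousLinearMap.le_opNorm _ _).trans ?_
        gcongr
        exact (ContinuousLinearMap.le_opNorm _ _).trans (by gcongr; exact hNM s)
      refine (intervalIntegral.norm_integral_le_of_norm_le ht.1 (ae_of_all _ hb)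
        (Continuous.intervalIntegrable (by fun_prop) _ _)).trans (le_of_eq ?_)
      have e : ∀ s : ℝ, C * (M * (X * ((C * M) ^ n * s ^ n / n.factorial)))
          = (X * (C * M) ^ (n + 1) / n.factorial) * s ^ n := fun s => by rw [pow_succ]; ring
      simp only [e]
      rw [intervalIntegral.integral_const_mul, integral_pow, Nat.factorial_succ]
      push_cast
      field_simp
      simp
  have hlim : Tendsto (fun n : ℕ => X * ((C * M) ^ n * t ^ n / n.factorial)) atTop (𝓝 0) := by
    have := (FloorSemiring.tendsto_pow_div_factorial_atTop (C * M * t)).const_mul X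
    simpa [mul_pow] using this
  have h0 : Tendsto (fun n => r n t) atTop (𝓝 0) :=
    squeeze_zero_norm (fun n => hbd n t ht) hlim
  have := h0.const_sub (x t)
  simpa [hr] using this

end Dyson

/-! ### Integration over ordered simplices -/

section OrderedTimes

lemma mem_orderedTimes_succ {k : ℕ} {τ : Fin (k + 2) → ℝ} :
    τ ∈ LPV.orderedTimes (k + 1) ↔ (Fin.init τ : Fin (k + 1) → ℝ) ∈ LPV.orderedTimes k ∧
      τ (Fin.last k).castSucc ≤ τ (Fin.last (k + 1)) := by
  simp only [LPV.orderedTimes, Set.mem_ofPred_eq, Fin.monotone_iff_le_succ, Fin.init]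
  rw [Fin.forall_fin_succ']
  simp only [Fin.succ_last, Fin.castSucc_zero, ← Fin.succ_castSucc, and_assoc]

lemma mem_orderedTimes_zero {τ : Fin (0 + 1) → ℝ} : τ ∈ LPV.orderedTimes 0 ↔ 0 ≤ τ 0 := by
  simp [LPV.orderedTimes, Subsingleton.monotone]

lemma measurableSet_orderedTimes (k : ℕ) : MeasurableSet (LPV.orderedTimes k) := by
  have : LPV.orderedTimes k = {τ | 0 ≤ τ 0} ∩ ⋂ i : Fin k, {τ | τ i.castSucc ≤ τ i.succ} := by
    ext τ; simp [LPV.orderedTimes, Fin.monotone_iff_le_succ]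
  rw [this]
  exact (measurableSet_le measurable_const (measurable_pi_apply _)).inter
    (MeasurableSet.iInter fun i => measurableSet_le (measurable_pi_apply _) (measurable_pi_apply _))

lemma lintegral_Icc_pow_div_factorial (k : ℕ) {a : ℝ} (ha : 0 ≤ a) :
    ∫⁻ r in Icc 0 a, ENNReal.ofReal (r ^ k / k.factorial)
      = ENNReal.ofReal (a ^ (k + 1) / (k + 1).factorial) := by
  rw [← ofReal_integral_eq_lintegral_ofReal]
  · rw [integral_Icc_eq_integral_Ioc, ← intervalIntegral.integral_of_le ha,
      intervalIntegral.integral_div, integral_pow, Nat.factorial_succ]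
    congr 1
    push_cast
    field_simp
    simp
  · exact (Continuous.continuousOn (by fun_prop)).integrableOn_Icc
  · filter_upwards [ae_restrict_mem measurableSet_Icc] with r hr
    have := hr.1
    simp only [Pi.zero_apply]; positivity

lemma Measurable.mul_pow_div_factorial {f : ℝ → ℝ≥0∞} (hf : Measurable f) (k : ℕ) :
    Measurable fun s : ℝ => f s * ENNReal.ofReal (s ^ k / k.factorial) :=
  hf.mul (by fun_prop)

/-- For last time `s`, the other `k` times fill a simplex of volume `s^k/k!`. In the induction the
last time is integrated out first, so `f` is replaced by its tail integral, and Tonelli then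
restores `f`. -/
lemma lintegral_orderedTimes_last (k : ℕ) {f : ℝ → ℝ≥0∞} (hf : Measurable f) :
    ∫⁻ τ in LPV.orderedTimes k, f (τ (Fin.last k))
      = ∫⁻ s in Ici 0, f s * ENNReal.ofReal (s ^ k / k.factorial) := by
  classical
  induction k generalizing f with
  | zero =>
    rw [← lintegral_indicator (measurableSet_orderedTimes 0), ← lintegral_indicator measurableSet_Ici,
      ← (volume_preserving_funUnique (Fin 1) ℝ).lintegral_comp
        ((hf.mul_pow_div_factorial 0).indicator measurableSet_Ici)]
    congr 1; ext τ
    simp [Set.indicator_apply, mem_orderedTimes_zero]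
  | succ k ih =>
    have hfm : Measurable fun q : ℝ × ℝ => {q : ℝ × ℝ | q.1 ≤ q.2}.indicator (fun q => f q.2) q :=
      (hf.comp measurable_snd).indicator (measurableSet_le measurable_fst measurable_snd)
    have hF : Measurable fun r => ∫⁻ a in Ici r, f a := by
      have : Measurable fun r => ∫⁻ a : ℝ, {q : ℝ × ℝ | q.1 ≤ q.2}.indicator
          (fun q => f q.2) (r, a) := hfm.lintegral_prod_right'
      convert this using 1
      ext r
      rw [← lintegral_indicator measurableSet_Ici]
      congr 1
    have hp := (volume_preserving_piFinSuccAbove (fun _ : Fin (k + 2) => ℝ) (Fin.last (k + 1)))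
    set G : ℝ × (Fin (k + 1) → ℝ) → ℝ≥0∞ := fun q =>
      {q : ℝ × (Fin (k + 1) → ℝ) | q.2 ∈ LPV.orderedTimes k ∧ q.2 (Fin.last k) ≤ q.1}.indicator
        (fun q => f q.1) q with hG
    have hGm : Measurable G := (hf.comp measurable_fst).indicator
      (((measurableSet_orderedTimes k).preimage measurable_snd).inter
      (measurableSet_le ((measurable_pi_apply _).comp measurable_snd) measurable_fst))
    have e1 : ∫⁻ τ in LPV.orderedTimes (k + 1), f (τ (Fin.last (k + 1)))
        = ∫⁻ q, G q ∂(volume.prod volume) := by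
      rw [← lintegral_indicator (measurableSet_orderedTimes _), ← Measure.volume_eq_prod,
        ← hp.lintegral_comp hGm]
      congr 1; ext τ
      simp only [hG, Set.indicator_apply, mem_orderedTimes_succ, MeasurableEquiv.piFinSuccAbove,
        Fin.insertNthEquiv, Set.mem_ofPred_eq]
      simp [Fin.init]
    rw [e1, lintegral_prod_symm' _ hGm]
    have e2 : ∀ b : Fin (k + 1) → ℝ, ∫⁻ a, G (a, b)
        = (LPV.orderedTimes k).indicator (fun b => ∫⁻ a in Ici (b (Fin.last k)), f a) b := fun b => by
      by_cases hb : b ∈ LPV.orderedTimes k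
      · rw [Set.indicator_of_mem hb, ← lintegral_indicator measurableSet_Ici]
        congr 1; ext a
        simp [hG, Set.indicator_apply, hb]
      · simp [hG, hb]
    simp only [e2]
    rw [lintegral_indicator (measurableSet_orderedTimes k), ih hF]
    have e3 : ∀ r, (∫⁻ a in Ici r, f a) * ENNReal.ofReal (r ^ k / k.factorial)
        = ∫⁻ a, {q : ℝ × ℝ | q.1 ≤ q.2}.indicator (fun q => f q.2) (r, a)
          * ENNReal.ofReal (r ^ k / k.factorial) := fun r => by
      rw [lintegral_mul_const _ (show Measurable fun a => {q : ℝ × ℝ | q.1 ≤ q.2}.indicator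
        (fun q => f q.2) (r, a) from hfm.comp measurable_prodMk_left),
        ← lintegral_indicator measurableSet_Ici]
      congr 1
    simp only [e3]
    rw [lintegral_lintegral_swap, ← lintegral_indicator measurableSet_Ici]
    · congr 1; ext a
      have e4 : ∀ r : ℝ, (Ici 0).indicator (fun r => {q : ℝ × ℝ | q.1 ≤ q.2}.indicator
          (fun q => f q.2) (r, a) * ENNReal.ofReal (r ^ k / k.factorial)) r
          = (Icc 0 a).indicator (fun r => f a * ENNReal.ofReal (r ^ k / k.factorial)) r := fun r => by
        simp only [Set.indicator_apply, Set.mem_Ici, Set.mem_Icc, Set.mem_ofPred_eq]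
        by_cases h1 : 0 ≤ r <;> by_cases h2 : r ≤ a <;> simp [h1, h2]
      rw [← lintegral_indicator measurableSet_Ici, lintegral_congr e4,
        lintegral_indicator measurableSet_Icc, lintegral_const_mul _ (by fun_prop)]
      by_cases ha : 0 ≤ a
      · rw [Set.indicator_of_mem (show a ∈ Ici 0 from ha), lintegral_Icc_pow_div_factorial k ha]
      · rw [Set.indicator_of_notMem (show a ∉ Ici 0 from ha), Set.Icc_eq_empty ha]
        simp
    · exact (hfm.mul (by fun_prop)).aemeasurable

/-- The factor `n^k` counts the index words of length `k`; together with the simplex volumes it sums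
to the exponential series. -/
lemma tsum_lintegral_orderedTimes_last (n : ℕ) {f : ℝ → ℝ≥0∞} (hf : Measurable f) :
    ∑' k : ℕ, (n : ℝ≥0∞) ^ k * ∫⁻ τ in LPV.orderedTimes k, f (τ (Fin.last k))
      = ∫⁻ s in Ici 0, f s * ENNReal.ofReal (Real.exp (n * s)) := by
  have h1 : ∀ k : ℕ, (n : ℝ≥0∞) ^ k * ∫⁻ τ in LPV.orderedTimes k, f (τ (Fin.last k))
      = ∫⁻ s in Ici 0, (n : ℝ≥0∞) ^ k * (f s * ENNReal.ofReal (s ^ k / k.factorial)) := fun k => by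
    rw [lintegral_orderedTimes_last k hf, lintegral_const_mul _ (hf.mul_pow_div_factorial k)]
  simp only [h1]
  rw [← lintegral_tsum fun k => ((hf.mul_pow_div_factorial k).const_mul _).aemeasurable]
  refine setLIntegral_congr_fun measurableSet_Ici fun s hs => ?_
  have hs : 0 ≤ s := hs
  have h2 : ∀ k : ℕ, (n : ℝ≥0∞) ^ k * (f s * ENNReal.ofReal (s ^ k / k.factorial))
      = f s * ENNReal.ofReal ((n * s) ^ k / k.factorial) := fun k => by
    rw [mul_left_comm, ← ENNReal.ofReal_natCast, ← ENNReal.ofReal_pow (by positivity),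
      ← ENNReal.ofReal_mul (by positivity), mul_pow, mul_div_assoc]
  simp only [h2]
  rw [ENNReal.tsum_mul_left, ← ENNReal.ofReal_tsum_of_nonneg (fun k => by positivity)
    (Real.summable_pow_div_factorial _)]
  congr 2
  rw [Real.exp_eq_exp_ℝ, NormedSpace.exp_eq_tsum_div]

end OrderedTimes

/-! ### Hilbert sums of `L²` spaces -/

section SquareSummable

/-- Finitely supported sequences are dense, and they span the images of countably many separable
spaces. Separability of the feature space is what reduces uncountable classes to countable ones. -/
lemma lp_secondCountableTopology {E : ℕ → Type*} [∀ k, NormedAddCommGroup (E k)]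
    [∀ k, InnerProductSpace ℝ (E k)] [∀ k, SecondCountableTopology (E k)] :
    SecondCountableTopology (lp E 2) := by
  have hsep : TopologicalSpace.IsSeparable
      (closure (Submodule.span ℝ (⋃ k, range (lp.single (E := E) 2 k)) : Set (lp E 2))) := by
    refine (TopologicalSpace.IsSeparable.span (TopologicalSpace.IsSeparable.iUnion fun k => ?_)).closure
    exact TopologicalSpace.isSeparable_range (lp.isometry_single (E := E) (p := 2) k).continuous
  have huniv : closure (Submodule.span ℝ (⋃ k, range (lp.single (E := E) 2 k)) : Set (lp E 2))
      = univ := by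
    refine Set.eq_univ_of_forall fun f => ?_
    refine mem_closure_of_tendsto (lp.hasSum_single ENNReal.ofNat_ne_top f)
      (Eventually.of_forall fun s => ?_)
    exact Submodule.sum_mem _ fun k _ => Submodule.subset_span
      (Set.mem_iUnion.mpr ⟨k, Set.mem_range_self _⟩)
  rw [huniv] at hsep
  have := TopologicalSpace.isSeparable_univ_iff.mp hsep
  exact UniformSpace.secondCountable_of_separable _

variable {α : ℕ → Type*} [∀ k, MeasurableSpace (α k)] {μ : ∀ k, Measure (α k)} {E : ℕ → Type*}
  [∀ k, NormedAddCommGroup (E k)]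

/-- A square summable sequence of square integrable functions is an element of the Hilbert sum. -/
lemma exists_lp_of_lintegral_ne_top {F : ∀ k, α k → E k}
    (hF : ∀ k, AEStronglyMeasurable (F k) (μ k))
    (h : ∑' k, ∫⁻ a, ‖F k a‖ₑ ^ 2 ∂μ k ≠ ∞) :
    ∃ v : lp (fun k => Lp (E k) 2 (μ k)) 2, (∀ k, (v k : α k → E k) =ᵐ[μ k] F k) ∧
      ‖v‖ₑ ^ 2 = ∑' k, ∫⁻ a, ‖F k a‖ₑ ^ 2 ∂μ k := by
  have hk : ∀ k, ∫⁻ a, ‖F k a‖ₑ ^ 2 ∂μ k ≠ ∞ := fun k => ENNReal.ne_top_of_tsum_ne_top h k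
  have he : ∀ k, eLpNorm (F k) 2 (μ k) ^ 2 = ∫⁻ a, ‖F k a‖ₑ ^ 2 ∂μ k := fun k => by
    have := eLpNorm_nnreal_pow_eq_lintegral (μ := μ k) (f := F k) (p := 2) two_ne_zero
    simpa using this
  have hm : ∀ k, MemLp (F k) 2 (μ k) := fun k => ⟨hF k, by
    have := hk k
    rw [← he k] at this
    exact lt_top_iff_ne_top.mpr fun ht => this (by simp [ht])⟩
  have hn : ∀ k, ‖(hm k).toLp (F k)‖ ^ 2 = (∫⁻ a, ‖F k a‖ₑ ^ 2 ∂μ k).toReal := fun k => by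
    rw [Lp.norm_toLp, ← he k, ENNReal.toReal_pow]
  have hmem : Memℓp (fun k => (hm k).toLp (F k)) 2 := by
    refine memℓp_gen ?_
    simpa only [ENNReal.toReal_ofNat, Real.rpow_ofNat, hn] using ENNReal.summable_toReal h
  refine ⟨⟨_, hmem⟩, fun k => (hm k).coeFn_toLp, ?_⟩
  have h2 := lp.norm_rpow_eq_tsum (p := 2) (by norm_num)
    (⟨_, hmem⟩ : lp (fun k => Lp (E k) 2 (μ k)) 2)
  simp only [ENNReal.toReal_ofNat, Real.rpow_ofNat, hn] at h2
  rw [← ENNReal.tsum_toReal_eq hk] at h2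
  rw [← ENNReal.ofReal_toReal h, ← h2, ← ofReal_norm, ENNReal.ofReal_pow (norm_nonneg _)]

lemma hasSum_integral_inner [∀ k, InnerProductSpace ℝ (E k)] {F G : ∀ k, α k → E k} {v w : lp (fun k => Lp (E k) 2 (μ k)) 2}
    (hv : ∀ k, (v k : α k → E k) =ᵐ[μ k] F k) (hw : ∀ k, (w k : α k → E k) =ᵐ[μ k] G k) :
    HasSum (fun k => ∫ a, inner ℝ (F k a) (G k a) ∂μ k) (inner ℝ v w) := by
  have e : ∀ k, ∫ a, inner ℝ (F k a) (G k a) ∂μ k = inner ℝ (v k) (w k) := fun k => by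
    rw [L2.inner_def]
    refine integral_congr_ae ?_
    filter_upwards [hv k, hw k] with a h1 h2
    rw [h1, h2]
  simp only [e]
  exact lp.hasSum_inner (𝕜 := ℝ) v w

end SquareSummable

/-! ### Matrix exponentials and regularity of scheduling signals -/

section MatrixFlow

/-- A square matrix as a bounded operator. -/
def matCLM {n : ℕ} (M : Matrix (Fin n) (Fin n) ℝ) : (Fin n → ℝ) →L[ℝ] (Fin n → ℝ) :=
  LinearMap.toContinuousLinearMap (Matrix.toLin' M)

@[simp] lemma matCLM_apply {n : ℕ} (M : Matrix (Fin n) (Fin n) ℝ) (v : Fin n → ℝ) :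
    matCLM M v = M *ᵥ v := by simp [matCLM]

/-- Matrices and operators are identified by an algebra isomorphism, continuous by finite dimension,
and such maps commute with `exp`. The norm on matrices is an auxiliary choice. -/
lemma matCLM_exp {n : ℕ} (M : Matrix (Fin n) (Fin n) ℝ) :
    matCLM (NormedSpace.exp M) = NormedSpace.exp (matCLM M) := by
  let _ : NormedRing (Matrix (Fin n) (Fin n) ℝ) := Matrix.linftyOpNormedRing
  let _ : NormedAlgebra ℝ (Matrix (Fin n) (Fin n) ℝ) := Matrix.linftyOpNormedAlgebra
  let _ : NormedAlgebra ℚ (Matrix (Fin n) (Fin n) ℝ) := NormedAlgebra.restrictScalars ℚ ℝ _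
  let f : Matrix (Fin n) (Fin n) ℝ ≃ₐ[ℝ] ((Fin n → ℝ) →L[ℝ] (Fin n → ℝ)) :=
    Matrix.toLinAlgEquiv'.trans (Module.End.toContinuousLinearMap _)
  have hf : Continuous f := LinearMap.continuous_of_finiteDimensional f.toLinearMap
  exact NormedSpace.map_exp f hf M

lemma opFlow_matCLM {n : ℕ} (M : Matrix (Fin n) (Fin n) ℝ) (t : ℝ) :
    opFlow (matCLM M) t = matCLM (NormedSpace.exp (t • M)) := by
  rw [matCLM_exp, opFlow]
  congr 1
  simp [matCLM]

end MatrixFlow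

section Signals

variable {np : ℕ} {T : ℝ}

/-- The line splits into `[0,T]` minus the finite exceptional set, where the signal is continuous,
the finite set itself, and the complement of `[0,T]`, where the signal is zero. -/
lemma Scheduling.measurable (p : Scheduling np T) : Measurable p.toFun := by
  obtain ⟨D, hD⟩ := p.piecewise
  have hc : ContinuousOn p.toFun (Icc 0 T \ D) := fun t ht =>
    ((hD t ht.1).1 (by simpa using ht.2)).mono sdiff_subset
  intro s hs
  have h1 : MeasurableSet (Icc 0 T \ (D : Set ℝ)) := measurableSet_Icc.diff D.measurableSet
  have e : p.toFun ⁻¹' s = ((Icc 0 T \ D) ∩ p.toFun ⁻¹' s) ∪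
      (((D : Set ℝ) ∩ Icc 0 T) ∩ p.toFun ⁻¹' s) ∪ ((Icc 0 T)ᶜ ∩ p.toFun ⁻¹' s) := by
    ext t
    by_cases h : t ∈ Icc 0 T <;> by_cases h' : t ∈ (D : Set ℝ) <;>
      simp only [mem_union, mem_inter_iff, Set.mem_sdiff, mem_compl_iff, h, h'] <;> tauto
  rw [e]
  refine (MeasurableSet.union ?_ ?_).union ?_
  · have hm : Measurable ((Icc 0 T \ (D : Set ℝ)).domRestrict p.toFun) :=
      (continuousOn_iff_continuous_domRestrict.mp hc).measurable
    have := (MeasurableEmbedding.subtype_coe h1).measurableSet_image' (hm hs)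
    convert this using 1
    ext t; simp [Set.domRestrict, and_comm]
  · exact ((D.finite_toSet.inter_of_left _).inter_of_left _).measurableSet
  · by_cases h0 : (0 : Fin np → ℝ) ∈ s
    · rw [Set.inter_eq_left.mpr fun t ht => by rw [mem_preimage, p.off t ht]; exact h0]
      exact measurableSet_Icc.compl
    · rw [(Set.disjoint_left.mpr fun t ht ht' => by
        rw [mem_preimage, p.off t ht] at ht'; exact h0 ht').inter_eq]
      exact MeasurableSet.empty

/-- The scheduling signal with the constant signal `1` put in front. -/
def Scheduling.ext1 (p : Scheduling np T) (t : ℝ) : Fin (np + 1) → ℝ := Fin.cons 1 (p.toFun t)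

lemma affineComb_eq_sum {V : Type*} [AddCommGroup V] [Module ℝ V] (M : Fin (np + 1) → V)
    (p : Scheduling np T) (t : ℝ) : affineComb M (p.toFun t) = ∑ j, p.ext1 t j • M j := by
  simp [affineComb, Fin.sum_univ_succ, Scheduling.ext1]

lemma Scheduling.abs_le_one (p : Scheduling np T) (t : ℝ) (i : Fin np) : |p.toFun t i| ≤ 1 :=
  abs_le.mpr (p.bounded t i)

lemma Scheduling.abs_ext1_le_one (p : Scheduling np T) (t : ℝ) (j : Fin (np + 1)) :
    |p.ext1 t j| ≤ 1 := by
  refine Fin.cases ?_ (fun i => ?_) j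
  · simp [Scheduling.ext1]
  · simpa [Scheduling.ext1] using p.abs_le_one t i

lemma Scheduling.measurable_apply (p : Scheduling np T) (i : Fin np) :
    Measurable fun t => p.toFun t i := (measurable_pi_apply i).comp p.measurable

lemma Scheduling.measurable_ext1 (p : Scheduling np T) (j : Fin (np + 1)) :
    Measurable fun t => p.ext1 t j := by
  refine Fin.cases ?_ (fun i => ?_) j
  · simp [Scheduling.ext1]
  · simpa [Scheduling.ext1] using p.measurable_apply i

end Signals

/-! ### Volterra expansion of an LPV system -/

namespace LPV

variable {nIn np : ℕ} {T : ℝ} (S : LPV nIn np) (u : L2Signal nIn T) (p : Scheduling np T)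

/-- The scheduled part `∑ᵢ pᵢ(t) Aᵢ` of the state matrix. -/
def schedOp (t : ℝ) : (Fin S.nx → ℝ) →L[ℝ] (Fin S.nx → ℝ) :=
  ∑ i, p.toFun t i • matCLM (S.A i.succ)

/-- The forcing term `B(p(t)) u(t)`, extended by zero off `[0,T]`. -/
def forcing : ℝ → Fin S.nx → ℝ :=
  (Icc 0 T).indicator fun t => affineComb S.B (p.toFun t) *ᵥ (u t).ofLp

lemma stronglyMeasurable_schedOp : StronglyMeasurable (S.schedOp p) := by
  refine Finset.stronglyMeasurable_fun_sum _ fun i _ => ?_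
  exact (p.measurable_apply i).stronglyMeasurable.smul_const _

lemma norm_schedOp_le (t : ℝ) : ‖S.schedOp p t‖ ≤ ∑ i : Fin np, ‖matCLM (S.A i.succ)‖ := by
  refine (norm_sum_le _ _).trans (Finset.sum_le_sum fun i _ => ?_)
  rw [norm_smul]
  exact mul_le_of_le_one_left (norm_nonneg _) (p.abs_le_one t i)

lemma schedOp_eq_zero {t : ℝ} (ht : t ∉ Icc 0 T) : S.schedOp p t = 0 := by
  simp [schedOp, p.off t ht]

lemma forcing_eq_zero {t : ℝ} (ht : t ∉ Icc 0 T) : S.forcing u p t = 0 :=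
  Set.indicator_of_notMem ht _

lemma forcing_eq_sum (t : ℝ) : affineComb S.B (p.toFun t) *ᵥ (u t).ofLp
    = ∑ j, p.ext1 t j • (S.B j *ᵥ (u t).ofLp) := by
  rw [affineComb_eq_sum, Matrix.sum_mulVec]
  simp only [Matrix.smul_mulVec]

/-- On the finite interval `L²` is contained in `L¹`, and the scheduling coefficients are bounded by
`1`. -/
lemma integrable_forcing : Integrable (S.forcing u p) := by
  refine (integrable_indicator_iff measurableSet_Icc).mpr ?_
  simp only [forcing_eq_sum]
  refine integrable_finsetSum _ fun j _ => ?_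
  have hu : Integrable (fun t => u t) (volume.restrict (Icc 0 T)) :=
    (Lp.memLp u).integrable one_le_two
  let L : EuclideanSpace ℝ (Fin nIn) →L[ℝ] (Fin S.nx → ℝ) :=
    LinearMap.toContinuousLinearMap ((Matrix.toLin' (S.B j)).comp
      (WithLp.linearEquiv 2 ℝ (Fin nIn → ℝ)).toLinearMap)
  have hL : Integrable (fun t => S.B j *ᵥ (u t).ofLp) (volume.restrict (Icc 0 T)) :=
    (L.integrable_comp hu).congr (ae_of_all _ fun t => by simp [L])
  refine Integrable.mono' hL.norm ((p.measurable_ext1 j).aestronglyMeasurable.smul hL.1)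
    (ae_of_all _ fun t => ?_)
  rw [norm_smul]
  exact mul_le_of_le_one_left (norm_nonneg _) (p.abs_ext1_le_one t j)

lemma rhs_eq {x : ℝ → Fin S.nx → ℝ} {t : ℝ} (ht : t ∈ Icc 0 T) :
    S.rhs u p x t = matCLM (S.A 0) (x t) + (S.schedOp p t (x t) + S.forcing u p t) := by
  rw [rhs, forcing, Set.indicator_of_mem ht, ← add_assoc]
  congr 1
  simp [affineComb, schedOp, Matrix.add_mulVec, Matrix.sum_mulVec, Matrix.smul_mulVec]

/-- The state of an LPV system at the final time is the sum of its Dyson series. -/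
lemma tendsto_dysonTerm_of_integral_eq {x : ℝ → Fin S.nx → ℝ} (hT : 0 ≤ T)
    (hi : IntervalIntegrable (S.rhs u p x) volume 0 T)
    (hx : ∀ t ∈ Icc (0 : ℝ) T, x t = ∫ s in (0 : ℝ)..t, S.rhs u p x s) :
    Tendsto (fun n => ∑ k ∈ Finset.range n,
      dysonTerm (matCLM (S.A 0)) (S.schedOp p) (S.forcing u p) k T) atTop (𝓝 (x T)) := by
  have hxc : ContinuousOn x (Icc 0 T) := by
    have h1 := intervalIntegral.continuousOn_primitive_interval'
      (a := 0) (b₁ := 0) (b₂ := T) hi (by simp)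
    rw [Set.uIcc_of_le hT] at h1
    exact h1.congr hx
  have hN := (S.stronglyMeasurable_schedOp p).aestronglyMeasurable (μ := volume)
  refine hasSum_dysonTerm hN (S.norm_schedOp_le p) (fun s hs => S.schedOp_eq_zero p hs)
    (S.integrable_forcing u p) (fun s hs => S.forcing_eq_zero u p hs) hxc (fun t ht => ?_)
    ⟨hT, le_rfl⟩
  have hsub : Ioc 0 t ⊆ Icc 0 T := fun s hs => ⟨hs.1.le, hs.2.trans ht.2⟩
  have hxi : IntegrableOn x (Ioc 0 t) := (hxc.integrableOn_Icc).mono_set hsub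
  refine duhamel (matCLM (S.A 0)) ht.1 ?_ hxi fun s hs => ?_
  · refine Integrable.add ?_ (S.integrable_forcing u p).integrableOn
    refine Integrable.mono' (hxi.norm.const_mul (∑ i : Fin np, ‖matCLM (S.A i.succ)‖))
      (AEStronglyMeasurable.clm_apply_fun hN.restrict hxi.1) (ae_of_all _ fun s => ?_)
    exact (ContinuousLinearMap.le_opNorm _ _).trans (by gcongr; exact S.norm_schedOp_le p s)
  · rw [hx s ⟨hs.1, hs.2.trans ht.2⟩]
    refine intervalIntegral.integral_congr fun r hr => ?_
    rw [Set.uIcc_of_le hs.1] at hr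
    exact S.rhs_eq u p ⟨hr.1, hr.2.trans (hs.2.trans ht.2)⟩

/-- The product of scheduling signals `p_j(t-τ_{k+1}) ∏ₘ p_{iₘ}(t-τ_{k+1}+τₘ)` in a Volterra term. -/
def schedProd (j : Fin (np + 1)) (k : ℕ) (i : Fin k → Fin np) (t : ℝ) (τ : Fin (k + 1) → ℝ) : ℝ :=
  p.ext1 (t - τ (Fin.last k)) j *
    ∏ m, p.toFun (t - τ (Fin.last k) + τ m.castSucc) (i m)

/-- The newest factor is evaluated at the current time of the outer convolution, and the others form
the shorter product as seen from that time. This mirrors the recursion of the Dyson integrand. -/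
lemma schedProd_snoc (j : Fin (np + 1)) (k : ℕ) (i : Fin k → Fin np) (i' : Fin np) (t : ℝ)
    (τ : Fin (k + 2) → ℝ) :
    schedProd p j (k + 1) (Fin.snoc i i') t τ
      = p.toFun (t + τ (Fin.last k).castSucc - τ (Fin.last (k + 1))) i' *
        schedProd p j k i (t + τ (Fin.last k).castSucc - τ (Fin.last (k + 1))) (Fin.init τ) := by
  unfold schedProd
  rw [Fin.prod_univ_castSucc]
  have h1 : t + τ (Fin.last k).castSucc - τ (Fin.last (k + 1)) - (Fin.init τ : Fin (k + 1) → ℝ)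
      (Fin.last k) = t - τ (Fin.last (k + 1)) := by simp only [Fin.init]; ring
  have h2 : t - τ (Fin.last (k + 1)) + τ (Fin.last k).castSucc
      = t + τ (Fin.last k).castSucc - τ (Fin.last (k + 1)) := by ring
  rw [h1]
  simp only [Fin.snoc_castSucc, Fin.snoc_last, h2]
  simp only [Fin.init]
  ring

lemma sum_fin_pi_succ {M ι : Type*} [AddCommMonoid M] [Fintype ι] {k : ℕ}
    (F : (Fin (k + 1) → ι) → M) :
    ∑ i, F i = ∑ i' : ι, ∑ i : Fin k → ι, F (Fin.snoc i i') := by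
  rw [← (Fin.snocEquiv fun _ => ι).sum_comp, Fintype.sum_prod_type]
  simp [Fin.snocEquiv]

open Classical in
/-- The terms of the Dyson series of an LPV system are given by its Volterra kernels. -/
lemma dysonIntegrand_eq (k : ℕ) {t : ℝ} (ht : t ≤ T) (τ : Fin (k + 1) → ℝ) :
    dysonIntegrand (matCLM (S.A 0)) (S.schedOp p) (S.forcing u p) k t τ
      = if τ ∈ orderedTimes k ∧ τ (Fin.last k) ≤ t then
          ∑ i : Fin k → Fin np, ∑ j, schedProd p j k i t τ •
            (S.stateKernel j k i τ *ᵥ (u (t - τ (Fin.last k))).ofLp)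
        else 0 := by
  induction k generalizing t with
  | zero =>
    simp only [dysonIntegrand, flowIntegrand, splitLast, add_zero, Set.indicator_apply,
      Set.mem_Iic, forcing, mem_orderedTimes_zero]
    have h1 : t - τ (Fin.last 0) ≤ t ↔ 0 ≤ τ 0 := by simp
    have h2 : t - (t - τ (Fin.last 0)) = τ 0 := by simp
    by_cases h3 : 0 ≤ τ 0
    · have h4 : t - τ (Fin.last 0) ∈ Icc 0 T ↔ τ (Fin.last 0) ≤ t := by
        rw [Set.mem_Icc, sub_nonneg, show τ (Fin.last 0) = τ 0 from rfl]
        exact ⟨fun h => h.1, fun h => ⟨h, by linarith⟩⟩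
      simp only [h1, h2, h3, if_true, true_and, h4]
      split_ifs with h5
      · rw [opFlow_matCLM, forcing_eq_sum]
        simp [schedProd, stateKernel]
      · simp
    · simp [h3]
  | succ k ih =>
    simp only [dysonIntegrand, flowIntegrand, splitLast, Set.indicator_apply, Set.mem_Iic,
      mem_orderedTimes_succ]
    -- Times count from the entry of the input, so `s` is the absolute time at which the last
    -- scheduled matrix acts. The input enters at `s` minus the previous elapsed time, that is, at
    -- `t` minus the last one, whatever the order `k`.
    set s := t + (Fin.init τ : Fin (k + 1) → ℝ) (Fin.last k) - τ (Fin.last (k + 1)) with hs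
    have hs' : s = t + τ (Fin.last k).castSucc - τ (Fin.last (k + 1)) := rfl
    have h1 : s ≤ t ↔ τ (Fin.last k).castSucc ≤ τ (Fin.last (k + 1)) := by
      rw [hs']; constructor <;> intro h <;> linarith
    by_cases h2 : s ≤ t
    · rw [if_pos h2, ih (h2.trans ht)]
      have h3 : (Fin.init τ : Fin (k + 1) → ℝ) (Fin.last k) ≤ s ↔ τ (Fin.last (k + 1)) ≤ t := by
        rw [hs]; constructor <;> intro h <;> linarith
      simp only [h3, h1.mp h2, and_true]
      split_ifs with h4
      · have h5 : t - s = τ (Fin.last (k + 1)) - τ (Fin.last k).castSucc := by rw [hs']; ring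
        have h6 : s - (Fin.init τ : Fin (k + 1) → ℝ) (Fin.last k) = t - τ (Fin.last (k + 1)) := by
          rw [hs]; ring
        rw [h5, opFlow_matCLM, sum_fin_pi_succ]
        simp only [schedProd_snoc, ← hs', h6, schedOp, _root_.sum_apply, map_sum,
          _root_.smul_apply, map_smul, Finset.smul_sum]
        rw [Finset.sum_comm (s := (Finset.univ : Finset (Fin np)))]
        refine Finset.sum_congr rfl fun i _ => ?_
        rw [Finset.sum_comm]
        refine Finset.sum_congr rfl fun i' _ => Finset.sum_congr rfl fun j _ => ?_
        rw [smul_smul, stateKernel, mul_comm]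
        simp only [Fin.snoc_last, Fin.init_snoc, matCLM_apply, Matrix.mulVec_mulVec,
          Matrix.mul_assoc]
      · simp
    · rw [if_neg h2, if_neg fun h => h2 (h1.mpr h.1.2)]

end LPV

/-! ### Kernel and signal features and their norms -/

lemma enorm_sq_euclideanSpace {ι : Type*} [Fintype ι] (x : EuclideanSpace ℝ ι) :
    ‖x‖ₑ ^ 2 = ENNReal.ofReal (∑ i, x i ^ 2) := by
  rw [← EuclideanSpace.real_norm_sq_eq, ← ofReal_norm, ENNReal.ofReal_pow (norm_nonneg _)]

lemma continuous_matrix_exp_smul {n : ℕ} (A : Matrix (Fin n) (Fin n) ℝ) :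
    Continuous fun t : ℝ => NormedSpace.exp (t • A) := by
  let _ : NormedRing (Matrix (Fin n) (Fin n) ℝ) := Matrix.linftyOpNormedRing
  let _ : NormedAlgebra ℝ (Matrix (Fin n) (Fin n) ℝ) := Matrix.linftyOpNormedAlgebra
  exact (differentiable_exp_smul_const ℝ A).continuous

namespace LPV

variable {nIn np : ℕ} {T : ℝ} (S : LPV nIn np) (u : L2Signal nIn T) (p : Scheduling np T) (lam : ℝ)

/-- The index set of the scalar Volterra kernels of order `k`: indices of `B`, of `C`, of the state
matrices and of the input channel. -/
abbrev KernelIdx (nIn np k : ℕ) : Type :=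
  Fin (np + 1) × Fin (np + 1) × (Fin k → Fin np) × Fin nIn

/-- The family of Volterra kernels of order `k`, weighted by `e^{lam t/2}`. -/
def kernelFeature (k : ℕ) (τ : Fin (k + 1) → ℝ) : EuclideanSpace ℝ (KernelIdx nIn np k) :=
  WithLp.toLp 2 fun q => S.volterraKernel q.1 q.2.1 k q.2.2.1 τ q.2.2.2 *
    Real.exp (lam * τ (Fin.last k) / 2)

/-- The family of products of input and scheduling signals that the Volterra kernels of order `k`
are integrated against, weighted by `e^{-lam t/2}`. -/
def signalFeature (k : ℕ) (τ : Fin (k + 1) → ℝ) : EuclideanSpace ℝ (KernelIdx nIn np k) :=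
  WithLp.toLp 2 fun q => if τ (Fin.last k) ≤ T then
    p.ext1 T q.2.1 * schedProd p q.1 k q.2.2.1 T τ * (u (T - τ (Fin.last k))).ofLp q.2.2.2 *
      Real.exp (-(lam * τ (Fin.last k) / 2)) else 0

lemma continuous_stateKernel (j : Fin (np + 1)) (k : ℕ) (i : Fin k → Fin np) :
    Continuous (S.stateKernel j k i) := by
  induction k with
  | zero =>
    exact ((continuous_matrix_exp_smul (S.A 0)).comp (continuous_apply 0)).matrix_mul
      continuous_const
  | succ k ih =>
    have h1 : Continuous fun τ : Fin (k + 2) → ℝ =>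
        τ (Fin.last (k + 1)) - τ (Fin.last k).castSucc := by fun_prop
    have h2 : Continuous fun τ : Fin (k + 2) → ℝ => (Fin.init τ : Fin (k + 1) → ℝ) :=
      continuous_pi fun m => continuous_apply _
    exact (((continuous_matrix_exp_smul (S.A 0)).comp h1).matrix_mul continuous_const).matrix_mul
      ((ih (Fin.init i)).comp h2)

lemma continuous_volterraKernel (j l : Fin (np + 1)) (k : ℕ) (i : Fin k → Fin np) (m : Fin nIn) :
    Continuous fun τ => S.volterraKernel j l k i τ m :=
  (continuous_apply m).comp
    (Continuous.matrix_vecMul continuous_const (S.continuous_stateKernel j k i))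

lemma continuous_kernelFeature (k : ℕ) : Continuous (S.kernelFeature lam k) := by
  refine (PiLp.continuous_toLp 2 _).comp (continuous_pi fun q => ?_)
  exact (S.continuous_volterraKernel _ _ _ _ _).mul (by fun_prop)

lemma measurable_schedProd (j : Fin (np + 1)) (k : ℕ) (i : Fin k → Fin np) (t : ℝ) :
    Measurable (schedProd p j k i t) := by
  refine ((p.measurable_ext1 j).comp (measurable_const.sub (measurable_pi_apply _))).mul ?_
  refine Finset.measurable_prod _ fun m _ => (p.measurable_apply (i m)).comp ?_
  exact (measurable_const.sub (measurable_pi_apply _)).add (measurable_pi_apply _)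

lemma measurable_signalFeature (k : ℕ) : Measurable (signalFeature u p lam k) := by
  have hu : Measurable u := (Lp.stronglyMeasurable u).measurable
  refine (PiLp.continuous_toLp 2 _).measurable.comp (measurable_pi_lambda _ fun q => ?_)
  refine Measurable.ite (measurableSet_le (measurable_pi_apply _) measurable_const) ?_
    measurable_const
  have h1 : Measurable fun τ : Fin (k + 1) → ℝ => (u (T - τ (Fin.last k))).ofLp q.2.2.2 :=
    (EuclideanSpace.proj q.2.2.2 : EuclideanSpace ℝ (Fin nIn) →L[ℝ] ℝ).measurable.comp
      (hu.comp (measurable_const.sub (measurable_pi_apply _)))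
  exact (((measurable_schedProd p _ _ _ _).const_mul _).mul h1).mul (by fun_prop)

lemma abs_schedProd_le_one (j : Fin (np + 1)) (k : ℕ) (i : Fin k → Fin np) (t : ℝ)
    (τ : Fin (k + 1) → ℝ) : |schedProd p j k i t τ| ≤ 1 := by
  rw [schedProd, abs_mul, Finset.abs_prod]
  exact mul_le_one₀ (p.abs_ext1_le_one _ _) (Finset.prod_nonneg fun _ _ => abs_nonneg _)
    (Finset.prod_le_one (fun _ _ => abs_nonneg _) fun _ _ => p.abs_le_one _ _)

/-- The sum of the squared `L²` norms of the weighted Volterra kernels is the squared weighted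
`H₂` norm. -/
lemma tsum_lintegral_kernelFeature :
    ∑' k, ∫⁻ τ in orderedTimes k, ‖S.kernelFeature lam k τ‖ₑ ^ 2 = S.h2NormSq lam := by
  have h1 : ∀ (k : ℕ) (τ : Fin (k + 1) → ℝ), ‖S.kernelFeature lam k τ‖ₑ ^ 2
      = ∑ j, ∑ l, ∑ i, ENNReal.ofReal ((∑ m, (S.volterraKernel j l k i τ m) ^ 2) *
        Real.exp (lam * τ (Fin.last k))) := fun k τ => by
    rw [enorm_sq_euclideanSpace]
    simp only [Fintype.sum_prod_type, kernelFeature]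
    have hnn : ∀ j l i, 0 ≤ (∑ m, (S.volterraKernel j l k i τ m) ^ 2) *
        Real.exp (lam * τ (Fin.last k)) := fun j l i => by positivity
    have e : Real.exp (lam * τ (Fin.last k)) = Real.exp (lam * τ (Fin.last k) / 2) ^ 2 := by
      rw [← Real.exp_nat_mul]; congr 1; push_cast; ring
    rw [ENNReal.ofReal_sum_of_nonneg fun j _ => Finset.sum_nonneg fun l _ =>
      Finset.sum_nonneg fun i _ => Finset.sum_nonneg fun m _ => sq_nonneg _]
    refine Finset.sum_congr rfl fun j _ => ?_
    rw [ENNReal.ofReal_sum_of_nonneg fun l _ =>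
      Finset.sum_nonneg fun i _ => Finset.sum_nonneg fun m _ => sq_nonneg _]
    refine Finset.sum_congr rfl fun l _ => ?_
    rw [ENNReal.ofReal_sum_of_nonneg fun i _ => Finset.sum_nonneg fun m _ => sq_nonneg _]
    refine Finset.sum_congr rfl fun i _ => ?_
    congr 1
    rw [e, Finset.sum_mul]
    exact Finset.sum_congr rfl fun m _ => mul_pow _ _ _
  have hm : ∀ j l k i, Measurable fun τ : Fin (k + 1) → ℝ =>
      ENNReal.ofReal ((∑ m, (S.volterraKernel j l k i τ m) ^ 2) *
        Real.exp (lam * τ (Fin.last k))) := fun j l k i => by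
    refine ENNReal.measurable_ofReal.comp (Continuous.measurable ?_)
    exact (continuous_finsetSum _ fun m _ => (S.continuous_volterraKernel j l k i m).pow 2).mul
      (by fun_prop)
  simp only [h1]
  have h2 : ∀ k : ℕ, ∫⁻ τ in orderedTimes k, ∑ j, ∑ l, ∑ i,
      ENNReal.ofReal ((∑ m, (S.volterraKernel j l k i τ m) ^ 2) * Real.exp (lam * τ (Fin.last k)))
      = ∑ j, ∑ l, ∑ i, ∫⁻ τ in orderedTimes k, ENNReal.ofReal
        ((∑ m, (S.volterraKernel j l k i τ m) ^ 2) * Real.exp (lam * τ (Fin.last k))) := fun k => by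
    rw [lintegral_finsetSum _ fun j _ => Finset.measurable_sum _ fun l _ =>
      Finset.measurable_sum _ fun i _ => hm j l k i]
    refine Finset.sum_congr rfl fun j _ => ?_
    rw [lintegral_finsetSum _ fun l _ => Finset.measurable_sum _ fun i _ => hm j l k i]
    refine Finset.sum_congr rfl fun l _ => ?_
    rw [lintegral_finsetSum _ fun i _ => hm j l k i]
  simp only [h2, h2NormSq]
  rw [Summable.tsum_finsetSum fun j _ => ENNReal.summable]
  refine Finset.sum_congr rfl fun j _ => ?_
  rw [Summable.tsum_finsetSum fun l _ => ENNReal.summable]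

/-- Every scheduling factor is at most `1` in absolute value, so only the index tuples need
counting: `(np+1)²` choices for `B` and `C`, and `np^k` words. The input channels add up to the
squared norm of `u`. -/
lemma enorm_signalFeature_sq_le (k : ℕ) (τ : Fin (k + 1) → ℝ) :
    ‖signalFeature u p lam k τ‖ₑ ^ 2 ≤ ((np : ℝ≥0∞) + 1) ^ 2 * ((np : ℝ≥0∞) ^ k *
      (Iic T).indicator (fun s => ‖u (T - s)‖ₑ ^ 2 * ENNReal.ofReal (Real.exp (-(lam * s))))
        (τ (Fin.last k))) := by
  by_cases h : τ (Fin.last k) ≤ T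
  · rw [Set.indicator_of_mem (show τ (Fin.last k) ∈ Iic T from h), enorm_sq_euclideanSpace,
      enorm_sq_euclideanSpace, ← ENNReal.ofReal_mul (by positivity)]
    simp only [signalFeature, if_pos h, Fintype.sum_prod_type]
    set v := u (T - τ (Fin.last k))
    set e := Real.exp (-(lam * τ (Fin.last k)))
    have he : e = Real.exp (-(lam * τ (Fin.last k) / 2)) ^ 2 := by
      change Real.exp (-(lam * τ (Fin.last k))) = _
      rw [← Real.exp_nat_mul]; congr 1; push_cast; ring
    have h1 : ∀ j l i m, (p.ext1 T l * schedProd p j k i T τ * v.ofLp m *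
        Real.exp (-(lam * τ (Fin.last k) / 2))) ^ 2 ≤ v.ofLp m ^ 2 * e := fun j l i m => by
      have h2 : (p.ext1 T l * schedProd p j k i T τ) ^ 2 ≤ 1 := by
        rw [sq_le_one_iff_abs_le_one, abs_mul]
        exact mul_le_one₀ (p.abs_ext1_le_one _ _) (abs_nonneg _) (abs_schedProd_le_one p _ _ _ _ _)
      rw [mul_pow, mul_pow, ← he, mul_assoc]
      exact mul_le_of_le_one_left (by positivity) h2
    calc _ ≤ ENNReal.ofReal (∑ _j : Fin (np + 1), ∑ _l : Fin (np + 1), ∑ _i : Fin k → Fin np,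
          ∑ m, v.ofLp m ^ 2 * e) := ENNReal.ofReal_le_ofReal <|
          Finset.sum_le_sum fun j _ => Finset.sum_le_sum fun l _ => Finset.sum_le_sum fun i _ =>
            Finset.sum_le_sum fun m _ => h1 j l i m
      _ = ENNReal.ofReal (((np : ℝ) + 1) ^ 2 * ((np : ℝ) ^ k * ((∑ m, v.ofLp m ^ 2) * e))) := by
          congr 1
          simp only [Finset.sum_const, Finset.card_univ, Fintype.card_fin, Fintype.card_pi,
            Finset.prod_const, nsmul_eq_mul, Finset.sum_mul]
          push_cast
          ring
      _ = _ := by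
          rw [ENNReal.ofReal_mul (by positivity), ENNReal.ofReal_mul (by positivity),
            ENNReal.ofReal_pow (by positivity), ENNReal.ofReal_pow (by positivity),
            ENNReal.ofReal_add (by positivity) zero_le_one, ENNReal.ofReal_natCast,
            ENNReal.ofReal_one]
  · have : signalFeature u p lam k τ = 0 := by
      ext q; simp [signalFeature, h]
    simp [this]

lemma enorm_sq_L2Signal : ‖u‖ₑ ^ 2 = ∫⁻ s in Icc 0 T, ‖u s‖ₑ ^ 2 := by
  have h := eLpNorm_nnreal_pow_eq_lintegral (μ := volume.restrict (Icc 0 T)) (f := u) (p := 2)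
    two_ne_zero
  rw [Lp.enorm_def]
  simpa using h

/-- The sum of the squared `L²` norms of the signal features is at most `(np + 1)² ‖u‖²`. -/
lemma tsum_lintegral_signalFeature_le (hlam : (np : ℝ) ≤ lam) :
    ∑' k, ∫⁻ τ in orderedTimes k, ‖signalFeature u p lam k τ‖ₑ ^ 2
      ≤ ((np : ℝ≥0∞) + 1) ^ 2 * ‖u‖ₑ ^ 2 := by
  have hu : Measurable u := (Lp.stronglyMeasurable u).measurable
  set f : ℝ → ℝ≥0∞ := (Iic T).indicator
    (fun s => ‖u (T - s)‖ₑ ^ 2 * ENNReal.ofReal (Real.exp (-(lam * s)))) with hf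
  have hum : Measurable fun s => ‖u (T - s)‖ₑ ^ 2 :=
    (hu.comp (measurable_const.sub measurable_id)).enorm.pow_const 2
  have hfm : Measurable f := (hum.mul (by fun_prop)).indicator measurableSet_Iic
  calc ∑' k, ∫⁻ τ in orderedTimes k, ‖signalFeature u p lam k τ‖ₑ ^ 2
      ≤ ∑' k : ℕ, ((np : ℝ≥0∞) + 1) ^ 2 * ((np : ℝ≥0∞) ^ k *
          ∫⁻ τ in orderedTimes k, f (τ (Fin.last k))) := ENNReal.tsum_le_tsum fun k => by
        have hm : Measurable fun τ : Fin (k + 1) → ℝ => f (τ (Fin.last k)) :=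
          hfm.comp (measurable_pi_apply _)
        rw [← lintegral_const_mul _ hm, ← lintegral_const_mul _ (hm.const_mul _)]
        exact lintegral_mono fun τ => enorm_signalFeature_sq_le u p lam k τ
    _ = ((np : ℝ≥0∞) + 1) ^ 2 * ∫⁻ s in Ici 0, f s * ENNReal.ofReal (Real.exp (np * s)) := by
        rw [ENNReal.tsum_mul_left, tsum_lintegral_orderedTimes_last np hfm]
    _ ≤ ((np : ℝ≥0∞) + 1) ^ 2 * ‖u‖ₑ ^ 2 := by
        gcongr
        rw [enorm_sq_L2Signal, ← lintegral_indicator measurableSet_Icc,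
          ← lintegral_sub_left_eq_self (μ := volume)
            (fun s => (Icc 0 T).indicator (fun s => ‖u s‖ₑ ^ 2) s) T, ← lintegral_indicator measurableSet_Ici]
        refine lintegral_mono fun s => ?_
        by_cases h0 : 0 ≤ s
        · by_cases hT : s ≤ T
          · rw [Set.indicator_of_mem (show s ∈ Ici 0 from h0), hf,
              Set.indicator_of_mem (show s ∈ Iic T from hT),
              Set.indicator_of_mem (show T - s ∈ Icc 0 T from ⟨by linarith, by linarith⟩),
              mul_assoc, ← ENNReal.ofReal_mul (Real.exp_pos _).le, ← Real.exp_add]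
            refine mul_le_of_le_one_right zero_le ?_
            -- The exponent is `(np - lam) * s`, nonpositive for `s ≥ 0` because `np ≤ lam`.
            rw [ENNReal.ofReal_le_one, Real.exp_le_one_iff]
            nlinarith
          · rw [Set.indicator_of_mem (show s ∈ Ici 0 from h0), hf,
              Set.indicator_of_notMem (show s ∉ Iic T from hT), zero_mul]
            exact zero_le
        · simp [Set.indicator_of_notMem (show s ∉ Ici 0 from h0)]

/-- The two exponential weights cancel, and expanding `C(p(T))` supplies the sum over the index of
`C`. -/
lemma inner_kernelFeature_signalFeature (k : ℕ) {τ : Fin (k + 1) → ℝ} (hτ : τ ∈ orderedTimes k) :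
    inner ℝ (S.kernelFeature lam k τ) (signalFeature u p lam k τ)
      = affineComb S.C (p.toFun T) ⬝ᵥ
        dysonIntegrand (matCLM (S.A 0)) (S.schedOp p) (S.forcing u p) k T τ := by
  classical
  rw [S.dysonIntegrand_eq u p k le_rfl]
  by_cases h : τ (Fin.last k) ≤ T
  · rw [if_pos ⟨hτ, h⟩, affineComb_eq_sum, PiLp.inner_apply]
    simp only [kernelFeature, signalFeature, if_pos h, Fintype.sum_prod_type]
    rw [sum_dotProduct]
    simp only [dotProduct_sum, dotProduct_smul, Matrix.dotProduct_mulVec, Matrix.smul_vecMul,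
      smul_dotProduct, smul_eq_mul]
    rw [Finset.sum_comm]
    refine Finset.sum_congr rfl fun l _ => ?_
    rw [Finset.sum_comm]
    refine Finset.sum_congr rfl fun i _ => ?_
    refine Finset.sum_congr rfl fun j _ => ?_
    rw [← volterraKernel, dotProduct, Finset.mul_sum, Finset.mul_sum]
    refine Finset.sum_congr rfl fun m _ => ?_
    have e : Real.exp (lam * τ (Fin.last k) / 2) * Real.exp (-(lam * τ (Fin.last k) / 2)) = 1 := by
      rw [← Real.exp_add, add_neg_cancel, Real.exp_zero]
    simp only [RCLike.inner_apply, conj_trivial]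
    linear_combination (p.ext1 T l * schedProd p j k i T τ *
      (u (T - τ (Fin.last k))).ofLp m * S.volterraKernel j l k i τ m) * e
  · rw [if_neg fun h' => h h'.2]
    have : signalFeature u p lam k τ = 0 := by
      ext q; simp [signalFeature, h]
    simp [this]

/-- The Hilbert space in which Volterra kernels and signals are paired. -/
abbrev FeatureSpace (nIn np : ℕ) : Type :=
  lp (fun k => Lp (EuclideanSpace ℝ (KernelIdx nIn np k)) 2
    ((volume : Measure (Fin (k + 1) → ℝ)).restrict (orderedTimes k))) 2

lemma secondCountableTopology_featureSpace : SecondCountableTopology (FeatureSpace nIn np) := by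
  have : Fact ((2 : ℝ≥0∞) ≠ ∞) := ⟨ENNReal.ofNat_ne_top⟩
  exact lp_secondCountableTopology

/-- The element of the feature space given by the Volterra kernels of an LPV system. -/
lemma exists_kernelFeature {c : ℝ} (hc : 0 ≤ c) (h : S.h2Norm lam ≤ ENNReal.ofReal c) :
    ∃ w : FeatureSpace nIn np, ‖w‖ ≤ c ∧ ∀ k,
      (w k : (Fin (k + 1) → ℝ) → EuclideanSpace ℝ (KernelIdx nIn np k))
        =ᵐ[volume.restrict (orderedTimes k)] S.kernelFeature lam k := by
  have h1 : S.h2NormSq lam ≤ ENNReal.ofReal c ^ 2 := by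
    have := ENNReal.rpow_le_rpow h (z := 2) (by norm_num)
    rw [h2Norm, ← ENNReal.rpow_mul] at this
    simpa using this
  have hne : S.h2NormSq lam ≠ ∞ := ne_top_of_le_ne_top (by simp) h1
  obtain ⟨w, hw, hn⟩ := exists_lp_of_lintegral_ne_top
    (μ := fun k => (volume : Measure (Fin (k + 1) → ℝ)).restrict (orderedTimes k))
    (F := S.kernelFeature lam) (fun k => (S.continuous_kernelFeature lam k).aestronglyMeasurable)
    (by rw [tsum_lintegral_kernelFeature]; exact hne)
  refine ⟨w, ?_, hw⟩
  rw [tsum_lintegral_kernelFeature] at hn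
  rw [← hn, ← ofReal_norm, ← ENNReal.ofReal_pow (norm_nonneg _), ← ENNReal.ofReal_pow hc,
    ENNReal.ofReal_le_ofReal_iff (by positivity)] at h1
  exact (sq_le_sq₀ (norm_nonneg _) hc).mp h1

/-- The element of the feature space given by an input and a scheduling signal. -/
lemma exists_signalFeature (hlam : (np : ℝ) ≤ lam) :
    ∃ φ : FeatureSpace nIn np, ‖φ‖ ≤ (np + 1) * ‖u‖ ∧ ∀ k,
      (φ k : (Fin (k + 1) → ℝ) → EuclideanSpace ℝ (KernelIdx nIn np k))
        =ᵐ[volume.restrict (orderedTimes k)] signalFeature u p lam k := by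
  have h1 := tsum_lintegral_signalFeature_le u p lam hlam
  have e : ((np : ℝ≥0∞) + 1) ^ 2 * ‖u‖ₑ ^ 2 = ENNReal.ofReal ((((np : ℝ) + 1) * ‖u‖) ^ 2) := by
    rw [mul_pow, ENNReal.ofReal_mul (by positivity), ENNReal.ofReal_pow (by positivity),
      ENNReal.ofReal_pow (by positivity), ofReal_norm, ENNReal.ofReal_add (by positivity)
      zero_le_one, ENNReal.ofReal_natCast, ENNReal.ofReal_one]
  rw [e] at h1
  obtain ⟨w, hw, hn⟩ := exists_lp_of_lintegral_ne_top
    (μ := fun k => (volume : Measure (Fin (k + 1) → ℝ)).restrict (orderedTimes k))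
    (F := signalFeature u p lam)
    (fun k => (measurable_signalFeature u p lam k).aestronglyMeasurable)
    (ne_top_of_le_ne_top ENNReal.ofReal_ne_top h1)
  refine ⟨w, ?_, hw⟩
  rw [← hn, ← ofReal_norm, ← ENNReal.ofReal_pow (norm_nonneg _),
    ENNReal.ofReal_le_ofReal_iff (by positivity)] at h1
  exact (sq_le_sq₀ (norm_nonneg _) (by positivity)).mp h1

/-- The output of an LPV system at the final time is the inner product of its Volterra kernels with
the features of the input and the scheduling signal. -/
lemma output_eq_inner (hT : 0 ≤ T) {y : ℝ → ℝ} (hy : S.IsOutput u p y)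
    {w φ : FeatureSpace nIn np}
    (hw : ∀ k, (w k : (Fin (k + 1) → ℝ) → EuclideanSpace ℝ (KernelIdx nIn np k))
        =ᵐ[volume.restrict (orderedTimes k)] S.kernelFeature lam k)
    (hφ : ∀ k, (φ k : (Fin (k + 1) → ℝ) → EuclideanSpace ℝ (KernelIdx nIn np k))
        =ᵐ[volume.restrict (orderedTimes k)] signalFeature u p lam k) :
    y T = inner ℝ w φ := by
  classical
  obtain ⟨x, hi, hx, hyx⟩ := hy
  rw [hyx T ⟨hT, le_rfl⟩]
  set c := affineComb S.C (p.toFun T)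
  let L : (Fin S.nx → ℝ) →L[ℝ] ℝ :=
    LinearMap.toContinuousLinearMap (dotProductBilin ℝ ℝ c)
  have hL : ∀ v, L v = c ⬝ᵥ v := fun v => rfl
  have h1 := (L.continuous.tendsto _).comp (S.tendsto_dysonTerm_of_integral_eq u p hT hi hx)
  have h2 := (hasSum_integral_inner hw hφ).tendsto_sum_nat
  -- The Dyson series and the series of kernel-signal pairings agree term by term, so their limits
  -- coincide.
  refine tendsto_nhds_unique ?_ h2
  rw [← hL]
  convert h1 using 1
  funext n
  simp only [Function.comp_apply, map_sum]
  refine Finset.sum_congr rfl fun k _ => ?_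
  have hint := integrable_dysonIntegrand (A := matCLM (S.A 0)) (T := T)
    (S.stronglyMeasurable_schedOp p).aestronglyMeasurable (S.norm_schedOp_le p)
    (fun s hs => S.schedOp_eq_zero p hs) (S.integrable_forcing u p)
    (fun s hs => S.forcing_eq_zero u p hs) k ⟨hT, le_rfl⟩
  -- Dyson terms integrate over all tuples, but the integrand vanishes off the ordered simplex on
  -- which the features live.
  have e : ∫ τ in orderedTimes k,
      L (dysonIntegrand (matCLM (S.A 0)) (S.schedOp p) (S.forcing u p) k T τ)
      = ∫ τ, L (dysonIntegrand (matCLM (S.A 0)) (S.schedOp p) (S.forcing u p) k T τ) :=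
    setIntegral_eq_integral_of_forall_compl_eq_zero fun τ hτ => by
      rw [S.dysonIntegrand_eq u p k le_rfl, if_neg fun h => hτ h.1, map_zero]
  rw [dysonTerm, ← L.integral_comp_comm hint, ← e]
  refine setIntegral_congr_fun (measurableSet_orderedTimes k) fun τ hτ => ?_
  exact S.inner_kernelFeature_signalFeature u p lam k hτ

end LPV

/-! ### From LPV outputs to risk bounds for neural ODEs -/

lemma NeuralODE.EmbedsInto.isOutput_output {nIn np : ℕ} {T : ℝ} {𝒰 : Set (L2Signal nIn T)}
    {S : NeuralODE nIn} {L : LPV nIn np} {ψ : 𝒰 → Scheduling np T} (h : S.EmbedsInto L ψ) (u : 𝒰) :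
    L.IsOutput (u : L2Signal nIn T) (ψ u) (S.output (u : L2Signal nIn T)) := by
  have hex := (h u).1
  rw [NeuralODE.output, dif_pos hex]
  exact (h u).2 _ hex.choose_spec

lemma pacBound_of_measure_le {nIn : ℕ} {T : ℝ} {𝒰 : Set (L2Signal nIn T)} {Z : Type*}
    [MeasurableSpace Z] {𝒟 : Measure Z} {ℓ : ℝ → ℝ → ℝ} {U : Z → 𝒰} {Y : Z → ℝ}
    {𝔖 : Set (NeuralODE nIn)} {N : ℕ} {δ R : ℝ}
    (h : Measure.pi (fun _ : Fin N => 𝒟) {s | ∃ S : 𝔖,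
      R < ∫ z, ℓ ((S : NeuralODE nIn).output (U z : L2Signal nIn T) T) (Y z) ∂𝒟
        - 1 / (N : ℝ) * ∑ k, ℓ ((S : NeuralODE nIn).output (U (s k) : L2Signal nIn T) T) (Y (s k))}
      ≤ ENNReal.ofReal δ) : PACBound 𝒟 ℓ U Y 𝔖 N δ R := by
  refine (measure_mono fun s hs => ?_).trans h
  simp only [Set.mem_compl_iff, Set.mem_ofPred_eq, not_forall, not_le] at hs
  obtain ⟨S, hS, hlt⟩ := hs
  exact ⟨⟨S, hS⟩, hlt⟩

/-- True and empirical risk both lie in `[-B, B]` for almost every sample. The sign of `B` is known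
only once the class has a member, hence the guarded form of `hR`; for an empty class the event is
vacuous. -/
lemma pacBound_of_two_mul_le {nIn : ℕ} {T : ℝ} {𝒰 : Set (L2Signal nIn T)} {Z : Type*}
    [MeasurableSpace Z] {𝒟 : Measure Z} [IsProbabilityMeasure 𝒟] {ℓ : ℝ → ℝ → ℝ} {U : Z → 𝒰}
    {Y : Z → ℝ} {𝔖 : Set (NeuralODE nIn)} {N : ℕ} (hN : 0 < N) {B δ R : ℝ}
    (hB : IsLossBound 𝒟 ℓ U Y 𝔖 B) (hR : 0 ≤ B → 2 * B ≤ R) : PACBound 𝒟 ℓ U Y 𝔖 N δ R := by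
  refine pacBound_of_measure_le (le_trans (le_of_eq ?_) zero_le)
  refine measure_mono_null ?_ (ae_pi_forall (N := N) 𝒟 hB)
  rintro s ⟨S, hS⟩ hs
  have h1 := hB.mono fun z h => h S S.2
  have h2 := gap_le_two_mul 𝒟 hN h1 fun k => hs k S S.2
  have h3 := hR (bound_nonneg_of_ae h1)
  simp only [lossAt] at h2
  linarith

end

theorem theorem3
    {nIn np : ℕ} {T : ℝ} (hT : 0 < T)
    -- the family of LPV systems, with its stability assumption
    (𝔏 : Set (LPV nIn np))
    (lam : ℝ) (hlam : (np : ℝ) ≤ lam) (hLMI : ∀ L ∈ 𝔏, L.SatisfiesLMI lam)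
    (c₁ : ℝ) (hc₁ : 0 < c₁) (hsup : ⨆ L ∈ 𝔏, L.h2Norm lam = ENNReal.ofReal c₁)
    -- the admissible inputs, the scheduling maps and the class of neural ODEs
    (𝒰 : Set (L2Signal nIn T))
    (Φ : Set (𝒰 → Scheduling np T))
    (𝔖 : Set (NeuralODE nIn))
    (hembed : ∀ S ∈ 𝔖, ∃ L ∈ 𝔏, ∃ ψ ∈ Φ, S.EmbedsInto L ψ)
    -- the loss function
    (ℓ : ℝ → ℝ → ℝ) (K : ℝ)
    (hLip : ∀ a a' b b' : ℝ, |ℓ a b - ℓ a' b'| ≤ K * (|a - a'| + |b - b'|))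
    (hdiag : ∀ y : ℝ, ℓ y y = 0)
    -- the data distribution: the joint law of the random variables `(U, Y)`
    {Z : Type*} [MeasurableSpace Z] (𝒟 : Measure Z) [IsProbabilityMeasure 𝒟]
    (U : Z → 𝒰) (Y : Z → ℝ) (hY : AEMeasurable Y 𝒟)
    (hout : ∀ S ∈ 𝔖, AEMeasurable (fun z => S.output (U z : L2Signal nIn T) T) 𝒟)
    (Lu c₂ : ℝ) (hLu : 0 < Lu) (hc₂ : 0 < c₂)
    (hdata : ∀ᵐ z ∂𝒟, ‖(U z : L2Signal nIn T)‖ ≤ Lu ∧ |Y z| < c₂)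
    -- sample size and confidence
    (N : ℕ) (hN : 0 < N) (δ : ℝ) (hδ : δ ∈ Ioo (0 : ℝ) 1) :
    IsLossBound 𝒟 ℓ U Y 𝔖 (2 * K * max c₂ (c₁ * Lu * (np + 1))) ∧
    ∀ B : ℝ, IsLossBound 𝒟 ℓ U Y 𝔖 B →
      (Φ.Finite →
        PACBound 𝒟 ℓ U Y 𝔖 N δ
          (2 * (Φ.ncard : ℝ) * K * c₁ * Lu * (np + 1) / √(N : ℝ)
            + B * √(2 * Real.log (2 / δ) / N))) ∧
      (∀ d : ℕ, HasVCDim (graphFamily Φ) d →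
        PACBound 𝒟 ℓ U Y 𝔖 N δ
          (√2 * B * (2 + √((d : ℝ) * Real.log (2 * Real.exp 1 * N / d)))
            + 2 * K * c₁ * Lu * (np + 1) / √(N : ℝ)
            + B * √(2 * Real.log (2 / δ) / N))) := by
  have hK : 0 ≤ K := lipschitz_const_nonneg hLip
  have hw : ∀ S : 𝔖, ∃ ψ : Φ, ∃ w : LPV.FeatureSpace nIn np, ‖w‖ ≤ c₁ ∧
      ∀ (u : 𝒰) (φ : LPV.FeatureSpace nIn np), (∀ k, (φ k : (Fin (k + 1) → ℝ) →
          EuclideanSpace ℝ (LPV.KernelIdx nIn np k)) =ᵐ[volume.restrict (LPV.orderedTimes k)]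
          LPV.signalFeature (u : L2Signal nIn T) (ψ.1 u) lam k) →
        (S : NeuralODE nIn).output (u : L2Signal nIn T) T = inner ℝ w φ := fun S => by
    obtain ⟨L, hL, ψ, hψ, he⟩ := hembed S S.2
    obtain ⟨w, hwc, hwk⟩ := L.exists_kernelFeature lam hc₁.le
      ((le_iSup₂ (f := fun L (_ : L ∈ 𝔏) => L.h2Norm lam) L hL).trans_eq hsup)
    exact ⟨⟨ψ, hψ⟩, w, hwc, fun u φ hφ =>
      L.output_eq_inner _ _ lam hT.le (he.isOutput_output u) hwk hφ⟩
  choose ψ w hwc hwφ using hw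
  -- The feature depends on the system only through its scheduling map, so a finite `Φ` leaves
  -- finitely many feature maps.
  choose φ hφn hφk using fun (p : Φ) (z : Z) =>
    LPV.exists_signalFeature (U z : L2Signal nIn T) (p.1 (U z)) lam hlam
  have hout_eq : ∀ (S : 𝔖) (z : Z),
      (S : NeuralODE nIn).output (U z : L2Signal nIn T) T = inner ℝ (w S) (φ (ψ S) z) :=
    fun S z => hwφ S (U z) _ (hφk (ψ S) z)
  have hr : (0 : ℝ) ≤ (np + 1) * Lu := by positivity
  have hφ : ∀ᵐ z ∂𝒟, ∀ p, ‖φ p z‖ ≤ (np + 1) * Lu := hdata.mono fun z hz p =>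
    (hφn p z).trans (by gcongr; exact hz.1)
  refine ⟨?_, fun B hB => ⟨fun hfin => ?_, fun d _ => ?_⟩⟩
  · filter_upwards [hdata, hφ] with z hz hφz S hS
    have h1 : |S.output (U z : L2Signal nIn T) T| ≤ c₁ * ((np + 1) * Lu) := by
      rw [hout_eq ⟨S, hS⟩ z]
      refine (abs_real_inner_le_norm _ _).trans ?_
      gcongr
      · exact hwc _
      · exact hφz _
    -- Comparison with `ℓ (Y z) (Y z) = 0` bounds the loss by `K` times the prediction error; each
    -- of prediction and target is at most the maximum, hence the factor `2`.
    have h2 := hLip (S.output (U z : L2Signal nIn T) T) (Y z) (Y z) (Y z)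
    rw [hdiag, sub_zero, sub_self, abs_zero, add_zero] at h2
    have h3 := abs_sub (S.output (U z : L2Signal nIn T) T) (Y z)
    have h4 := le_max_left c₂ (c₁ * Lu * (np + 1))
    have h5 := le_max_right c₂ (c₁ * Lu * (np + 1))
    calc |lossAt ℓ U Y S z| ≤ K * |S.output (U z : L2Signal nIn T) T - Y z| := h2
      _ ≤ K * (2 * max c₂ (c₁ * Lu * (np + 1))) := by
        refine mul_le_mul_of_nonneg_left ?_ hK
        linarith [hz.2]
      _ = 2 * K * max c₂ (c₁ * Lu * (np + 1)) := by ring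
  · have := hfin.fintype
    have := LPV.secondCountableTopology_featureSpace (nIn := nIn) (np := np)
    have key := measure_pi_gap_features_le 𝒟 w ψ φ
      (fun S => by simpa only [← hout_eq S] using hout S S.2) hc₁.le hwc hr hφ hLip hY
      (B := B) (hB.mono fun z hz S => by simpa only [lossAt, hout_eq S z] using hz S S.2) hN hδ
    refine pacBound_of_measure_le ?_
    have e : 2 * (Fintype.card Φ * K * c₁ * ((np + 1) * Lu) * √(N : ℝ)) / N
        = 2 * (Φ.ncard : ℝ) * K * c₁ * Lu * (np + 1) / √(N : ℝ) := by
      rw [← Nat.card_eq_fintype_card, Nat.card_coe_set_eq, ← mul_assoc, mul_div_assoc,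
        Real.sqrt_div_self']
      ring
    rw [e] at key
    simpa only [hout_eq] using key
  · refine pacBound_of_two_mul_le hN hB fun hB0 => ?_
    have h1 : (2 : ℝ) * B ≤ √2 * B * 2 := by
      have : (1 : ℝ) ≤ √2 := Real.one_le_sqrt.mpr one_le_two
      nlinarith
    have h2 : 0 ≤ √2 * B * √((d : ℝ) * Real.log (2 * Real.exp 1 * N / d)) := by positivity
    have h3 : 0 ≤ 2 * K * c₁ * Lu * (np + 1) / √(N : ℝ) := by positivity
    have h4 : 0 ≤ B * √(2 * Real.log (2 / δ) / N) := by positivity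
    linarith
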